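/- Notation. Let $n\ge 1$, $\delta\in(0,1)$, $0<\lambda\le\Lambda$, $\alpha\in(0,2)$. Write $B_r=\{x\in\mathbb R^n:|x|<r\}$ and $|E|$ for the Lebesgue measure of $E$. For a unit vector $\xi$ let $V_\xi=\{z\ne 0: |\langle z/|z|,\xi\rangle|\ge\delta\}$. Let $\mathcal A_{sec}$ be the set of measurable $K:\mathbb R^n\to\mathbb R$ with $K(-h)=K(h)$ for which there is a unit vector $\xi$ with $$\mathbf 1_{V_\xi}(h)\frac{\lambda(2-\alpha)}{|h|^{n+\alpha}}\le K(h)\le\frac{\Lambda(2-\alpha)}{|h|^{n+\alpha}}\qquad(h\neq0),$$ and let $M^+v(x)=\sup_{K\in\mathcal A_{sec}}\int_{\mathbb R^n}\bigl(v(x+h)+v(x-h)-2v(x)\bigr)K(h)\,dh$, where the integrals may take the value $-\infty$. We say that $M^+u\ge -f$ in $B_1$ in the viscosity sense if $u$ is upper semicontinuous in $\overline{B_1}$ and, for all $x\in B_1$, all open neighbourhoods $N\subset B_1$ of $x$ and all $\varphi\in C^2(\overline N)$ with $\varphi(x)=u(x)$ and $\varphi>u$ on $N\setminus\{x\}$,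 the function $v$ that equals $\varphi$ in $N$ and $u$ outside $N$ satisfies $M^+v(x)\ge -f(x)$. For $u:\mathbb R^n\to\mathbb R$ let $\Gamma$ be the concave envelope of $u^+=\max(u,0)$ in $B_3$, that is, $\Gamma(x)=\inf\{p(x): p\text{ affine},\ p\ge u^+\text{ in }B_3\}$ for $x\in B_3$ and $\Gamma=0$ outside $B_3$. Let $\Sigma=\{u=\Gamma\}\cap B_1$, and for a set $A$ let $\nabla\Gamma(A)$ be the set of all elements of the superdifferentials of $\Gamma$ in $B_3$ at points of $A\cap B_3$. Cubes are open with sides parallel to the axes, $\eta Q$ is the concentric dilation of $Q$ by the factor $\eta$, and $\sup_{\overline Q}f$ is taken over $\overline Q\cap\overline{B_1}$, where $f$ is defined. Statement. There are $l\in(0,\tfrac12)$ and $\nu>0$ depending only on $n,\delta$ such that for all $\lambda>0$ and $0<\rho_0\le\frac{l}{16n}$ there are constants $C_2,C_3\ge1$ depending only on $n,\delta,\rho_0,\lambda$ with the following property. Let $\Lambda\ge\lambda$ and $\alpha\in(0,2)$, let $f\in C(\overline{B_1})$ with $f\ge0$, and let $u:\mathbb R^n\to\mathbb R$ be measurable with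 $M^+u\ge-f$ in $B_1$ in the viscosity sense and $u\le0$ in $\mathbb R^n\setminus B_1$. Then there is a finite (possibly empty) family of disjoint open cubes $(Q^j)_{j=1,\dots,m}$ with diameters $0<d_j\le\rho_0 2^{-1/(2-\alpha)}$ such that $\Sigma\subset\bigcup_j\overline{Q^j}$ and, for every $j$, 1. $\Sigma\cap\overline{Q^j}\ne\emptyset$, 2. $|\nabla\Gamma(\overline{Q^j})|\le C_2(\sup_{\overline{Q^j}}f)^n|Q^j|$, 3. $\bigl|\{y\in\eta Q^j: u(y)\ge\Gamma(y)-C_2(\sup_{\overline{Q^j}}f)\,d_j^2\}\bigr|\ge\nu|\eta Q^j|$, where $\eta=(1+\tfrac8l)\sqrt n$. Moreover, for every family of cubes with these properties, $$\sup_{B_1}u^+\le C_3\Bigl(\sum_{j=1}^m(\sup_{\overline{Q^j}}f)^n|Q^j|\Bigr)^{1/n}<\infty.$$ -/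

import Mathlib

open MeasureTheory Metric
open scoped ENNReal

noncomputable section

namespace NonlocalABP

/-- The double cone `V_ξ` of directions `z` with `|⟨z/|z|, ξ⟩| ≥ δ` (it does not contain `0`
when `δ > 0`). -/
def sector {n : ℕ} (δ : ℝ) (ξ : EuclideanSpace ℝ (Fin n)) : Set (EuclideanSpace ℝ (Fin n)) :=
  {z | δ ≤ |inner ℝ (‖z‖⁻¹ • z) ξ|}

/-- The class `𝒜_sec` of symmetric (Lebesgue measurable) kernels that lie everywhere below
`(2 - α) Λ |h|^(-n-α)` and, in some double cone, above `(2 - α) lam |h|^(-n-α)`. -/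
def sectorKernels (n : ℕ) (δ lam Lam α : ℝ) : Set (EuclideanSpace ℝ (Fin n) → ℝ) :=
  {K | AEMeasurable K volume ∧ (∀ h, K (-h) = K h) ∧
    ∃ ξ : EuclideanSpace ℝ (Fin n), ‖ξ‖ = 1 ∧ ∀ h, h ≠ 0 →
      (sector δ ξ).indicator (fun z => lam * (2 - α) / ‖z‖ ^ ((n : ℝ) + α)) h ≤ K h ∧
      K h ≤ Lam * (2 - α) / ‖h‖ ^ ((n : ℝ) + α)}

/-- The symmetric second difference `u(x+h) + u(x-h) - 2u(x)`. -/
def secondDiff {n : ℕ} (u : EuclideanSpace ℝ (Fin n) → ℝ) (x h : EuclideanSpace ℝ (Fin n)) : ℝ :=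
  u (x + h) + u (x - h) - 2 * u x

/-- The linear operator `L_K u(x) = ∫ δ²_h u(x) K(h) dh`, with values in `[-∞, ∞]`: the integral
of the positive part minus the integral of the negative part. The value `-∞` is possible when `u`
is not bounded from below. -/
def linOp {n : ℕ} (K u : EuclideanSpace ℝ (Fin n) → ℝ) (x : EuclideanSpace ℝ (Fin n)) : EReal :=
  ((∫⁻ h, ENNReal.ofReal (secondDiff u x h * K h) : ℝ≥0∞) : EReal) -
    ((∫⁻ h, ENNReal.ofReal (-(secondDiff u x h * K h)) : ℝ≥0∞) : EReal)

/-- The maximal operator `M⁺ u(x) = sup_{K ∈ 𝒜_sec} L_K u(x)`. -/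
def maxOp {n : ℕ} (δ lam Lam α : ℝ) (u : EuclideanSpace ℝ (Fin n) → ℝ)
    (x : EuclideanSpace ℝ (Fin n)) : EReal :=
  ⨆ K ∈ sectorKernels n δ lam Lam α, linOp K u x

open Classical in
/-- `M⁺ u ≥ -f` in `Ω` in the viscosity sense: `u` is upper semicontinuous in `closure Ω` and,
whenever a `C²` function `φ` touches `u` strictly from above at `x ∈ Ω` in a neighbourhood
`N ⊆ Ω` of `x`, the function that equals `φ` in `N` and `u` outside `N` satisfies the inequality
at `x`. -/
def IsViscositySubsolution {n : ℕ} (δ lam Lam α : ℝ) (Ω : Set (EuclideanSpace ℝ (Fin n)))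
    (u f : EuclideanSpace ℝ (Fin n) → ℝ) : Prop :=
  UpperSemicontinuousOn u (closure Ω) ∧
  ∀ x ∈ Ω, ∀ N : Set (EuclideanSpace ℝ (Fin n)), IsOpen N → x ∈ N → N ⊆ Ω →
    ∀ φ : EuclideanSpace ℝ (Fin n) → ℝ, ContDiffOn ℝ 2 φ (closure N) →
      φ x = u x → (∀ y ∈ N, y ≠ x → u y < φ y) →
      ((-f x : ℝ) : EReal) ≤ maxOp δ lam Lam α (N.piecewise φ u) x

/-- The concave envelope `Γ` of `u⁺` in `B₃`, extended by `0` outside `B₃`. -/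
def concaveEnvelope {n : ℕ} (u : EuclideanSpace ℝ (Fin n) → ℝ) :
    EuclideanSpace ℝ (Fin n) → ℝ :=
  (ball 0 3).indicator fun x =>
    sInf {t | ∃ p : EuclideanSpace ℝ (Fin n) →ᵃ[ℝ] ℝ,
      (∀ y ∈ ball (0 : EuclideanSpace ℝ (Fin n)) 3, max (u y) 0 ≤ p y) ∧ t = p x}

/-- The contact set `Σ = {u = Γ} ∩ B₁`. -/
def contactSet {n : ℕ} (u : EuclideanSpace ℝ (Fin n) → ℝ) : Set (EuclideanSpace ℝ (Fin n)) :=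
  {x | u x = concaveEnvelope u x} ∩ ball 0 1

/-- `∇g(A)`: all elements of the superdifferentials in `B₃` of `g` at the points of `A`. -/
def gradImage {n : ℕ} (g : EuclideanSpace ℝ (Fin n) → ℝ) (A : Set (EuclideanSpace ℝ (Fin n))) :
    Set (EuclideanSpace ℝ (Fin n)) :=
  {p | ∃ x ∈ A ∩ ball 0 3, ∀ y ∈ ball (0 : EuclideanSpace ℝ (Fin n)) 3,
    g y ≤ g x + inner ℝ p (y - x)}

/-- The open cube with centre `c` and side length `s`; its concentric dilation by the factor `t`
is `openCube c (t * s)`. -/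
def openCube {n : ℕ} (c : EuclideanSpace ℝ (Fin n)) (s : ℝ) : Set (EuclideanSpace ℝ (Fin n)) :=
  {x | ∀ i, |x i - c i| < s / 2}

/-- The supremum of `f` over a closed cube. As `f` is given on the closed unit ball only, it is
taken over the part of the closed cube in that ball. -/
def cubeSup {n : ℕ} (f : EuclideanSpace ℝ (Fin n) → ℝ) (c : EuclideanSpace ℝ (Fin n)) (s : ℝ) :
    ℝ :=
  sSup (f '' (closure (openCube c s) ∩ closedBall 0 1))

/-- The properties of the finite cube covering of the contact set: disjoint open cubes with
diameters in `(0, D]`, whose closures cover the contact set and meet it, with the estimate of the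
image of the gradient of `Γ` (constant `C₂`) and the estimate of the set where `u` is close to `Γ`
(constants `C₂`, `ν`, dilation factor `η`). -/
structure IsCubeCovering {n m : ℕ} (u f : EuclideanSpace ℝ (Fin n) → ℝ) (D C₂ ν η : ℝ)
    (c : Fin m → EuclideanSpace ℝ (Fin n)) (s : Fin m → ℝ) : Prop where
  side_pos : ∀ j, 0 < s j
  disjoint : Pairwise fun i j => Disjoint (openCube (c i) (s i)) (openCube (c j) (s j))
  diam_le : ∀ j, diam (openCube (c j) (s j)) ≤ D
  covers : contactSet u ⊆ ⋃ j, closure (openCube (c j) (s j))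
  meets : ∀ j, (contactSet u ∩ closure (openCube (c j) (s j))).Nonempty
  gradient : ∀ j, volume (gradImage (concaveEnvelope u) (closure (openCube (c j) (s j)))) ≤
    ENNReal.ofReal (C₂ * cubeSup f (c j) (s j) ^ n) * volume (openCube (c j) (s j))
  detachment : ∀ j, ENNReal.ofReal ν * volume (openCube (c j) (η * s j)) ≤
    volume {y | y ∈ openCube (c j) (η * s j) ∧
      concaveEnvelope u y - C₂ * cubeSup f (c j) (s j) * diam (openCube (c j) (s j)) ^ 2 ≤ u y}

end NonlocalABP

end

open NonlocalABP

/-! This is a nonlocal Aleksandrov–Bakelman–Pucci argument. At a contact point `x` a plane with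
slope `p` supports `u⁺` in `B₃`, and all second differences of `u` at `x` are nonpositive. Testing
the equation with this plane, bent slightly upwards near `x`, bounds the integral of the negated
second differences against `λ(2-α)|h|^(-n-α)`, over some cone minus a small ball, by any `M > f x`
(`exists_lintegral_secondDiff_le`).

The dyadic radii `r k` satisfy `(2-α) ∑ r k ^ (2-α) ≥ ρ₀²/4` uniformly in `α`
(`exists_le_sum_rpow`). Hence the second difference cannot be below `-C M r²` on a sizeable part of
every ring, and one ring is good (`exists_volume_le`). There both `u (x + h)` and `u (x - h)` are
close to the plane for most `h` in a ball inside the cone. Writing a point near `x` as the midpoint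
of two such points shows that `Γ` is close to the plane in a full ball around `x`
(`isGoodRadius_of_volume_le`). A concave function within `T` of a plane at scale `r` has slopes
within a multiple of `T/r` of `p`, which is the gradient estimate.

The good radius varies with `x`, but only finitely many scales occur, so a stopping-time choice in
the dyadic grid yields finitely many disjoint cubes (`exists_dyadic_covering`).

For the maximum principle, every slope shorter than `u x₀ / 4` occurs at a contact point
(`ball_subset_gradImage`). The volume of this ball of slopes is therefore at most the sum of the
gradient images of the cubes. -/

namespace NonlocalABP

variable {n : ℕ} {u f : EuclideanSpace ℝ (Fin n) → ℝ}

/-! ### Affine majorants, supporting planes and the concave envelope. -/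

/-- The affine function `y ↦ a + ⟨b, y⟩` lies above `u⁺` in `B₃`. -/
def IsMajorant (u : EuclideanSpace ℝ (Fin n) → ℝ) (a : ℝ) (b : EuclideanSpace ℝ (Fin n)) : Prop :=
  ∀ y ∈ ball (0 : EuclideanSpace ℝ (Fin n)) 3, max (u y) 0 ≤ a + inner ℝ b y

/-- The affine function through `(x, u x)` with gradient `p` lies above `u⁺` in `B₃`. -/
def IsSupportingAt (u : EuclideanSpace ℝ (Fin n) → ℝ) (x p : EuclideanSpace ℝ (Fin n)) : Prop :=
  ∀ y ∈ ball (0 : EuclideanSpace ℝ (Fin n)) 3, max (u y) 0 ≤ u x + inner ℝ p (y - x)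

theorem exists_eq_add_inner (p : EuclideanSpace ℝ (Fin n) →ᵃ[ℝ] ℝ) :
    ∃ b : EuclideanSpace ℝ (Fin n), ∀ y, p y = p 0 + inner ℝ b y := by
  refine ⟨(InnerProductSpace.toDual ℝ _).symm (LinearMap.toContinuousLinearMap p.linear),
    fun y => ?_⟩
  rw [InnerProductSpace.toDual_symm_apply]
  have := congrFun (AffineMap.decomp p) y
  simp only [Pi.add_apply] at this
  rw [this, add_comm]
  rfl

theorem concaveEnvelope_eq {x : EuclideanSpace ℝ (Fin n)} (hx : x ∈ ball 0 3) :
    concaveEnvelope u x = sInf {t | ∃ a b, IsMajorant u a b ∧ t = a + inner ℝ b x} := by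
  rw [concaveEnvelope, Set.indicator_of_mem hx]
  congr 1
  ext t
  constructor
  · rintro ⟨p, hp, rfl⟩
    obtain ⟨b, hb⟩ := exists_eq_add_inner p
    exact ⟨p 0, b, fun y hy => by rw [← hb]; exact hp y hy, hb x⟩
  · rintro ⟨a, b, hab, rfl⟩
    let p : EuclideanSpace ℝ (Fin n) →ᵃ[ℝ] ℝ :=
      (innerₛₗ ℝ b).toAffineMap + AffineMap.const ℝ _ a
    have hp : ∀ y, p y = a + inner ℝ b y := fun y => by simp [p, add_comm]
    exact ⟨p, fun y hy => by rw [hp]; exact hab y hy, (hp x).symm⟩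

theorem bddBelow_majorant_values {x : EuclideanSpace ℝ (Fin n)} (hx : x ∈ ball 0 3) :
    BddBelow {t | ∃ a b, IsMajorant u a b ∧ t = a + inner ℝ b x} := by
  refine ⟨0, ?_⟩
  rintro t ⟨a, b, hab, rfl⟩
  exact (le_max_right _ _).trans (hab x hx)

theorem concaveEnvelope_le {a : ℝ} {b x : EuclideanSpace ℝ (Fin n)} (h : IsMajorant u a b)
    (hx : x ∈ ball 0 3) : concaveEnvelope u x ≤ a + inner ℝ b x := by
  rw [concaveEnvelope_eq hx]
  exact csInf_le (bddBelow_majorant_values hx) ⟨a, b, h, rfl⟩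

theorem exists_isMajorant (hu : BddAbove (Set.range u)) :
    ∃ a, 0 ≤ a ∧ IsMajorant u a 0 := by
  obtain ⟨c, hc⟩ := hu
  refine ⟨max c 0, le_max_right _ _, fun y _ => ?_⟩
  simp only [inner_zero_left, add_zero]
  exact max_le_max (hc ⟨y, rfl⟩) le_rfl

theorem le_concaveEnvelope (hu : BddAbove (Set.range u)) {x : EuclideanSpace ℝ (Fin n)} {t : ℝ}
    (hx : x ∈ ball 0 3) (h : ∀ a b, IsMajorant u a b → t ≤ a + inner ℝ b x) :
    t ≤ concaveEnvelope u x := by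
  rw [concaveEnvelope_eq hx]
  refine le_csInf ?_ ?_
  · obtain ⟨a, -, ha⟩ := exists_isMajorant hu
    exact ⟨_, a, 0, ha, rfl⟩
  · rintro s ⟨a, b, hab, rfl⟩
    exact h a b hab

theorem max_le_concaveEnvelope (hu : BddAbove (Set.range u)) {x : EuclideanSpace ℝ (Fin n)}
    (hx : x ∈ ball 0 3) : max (u x) 0 ≤ concaveEnvelope u x :=
  le_concaveEnvelope hu hx fun _ _ hab => hab x hx

theorem IsSupportingAt.isMajorant {x p : EuclideanSpace ℝ (Fin n)} (h : IsSupportingAt u x p) :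
    IsMajorant u (u x - inner ℝ p x) p := fun y hy => by
  have := h y hy
  rw [inner_sub_right] at this
  linarith

theorem IsSupportingAt.concaveEnvelope_le {x p y : EuclideanSpace ℝ (Fin n)}
    (h : IsSupportingAt u x p) (hy : y ∈ ball 0 3) :
    concaveEnvelope u y ≤ u x + inner ℝ p (y - x) := by
  have := NonlocalABP.concaveEnvelope_le h.isMajorant hy
  rw [inner_sub_right]
  linarith

theorem isClosed_setOf_isMajorant :
    IsClosed {q : ℝ × EuclideanSpace ℝ (Fin n) | IsMajorant u q.1 q.2} := by
  simp only [IsMajorant, Set.ofPred_forall]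
  refine isClosed_iInter fun y => isClosed_iInter fun _ => ?_
  exact isClosed_le continuous_const (by fun_prop)

/-- The infimum which defines the concave envelope is attained, at points of the unit ball. -/
theorem exists_isMajorant_eq (hu : BddAbove (Set.range u)) {x : EuclideanSpace ℝ (Fin n)}
    (hx : x ∈ ball 0 1) : ∃ a b, IsMajorant u a b ∧ a + inner ℝ b x = concaveEnvelope u x := by
  obtain ⟨c, hc0, hc⟩ := exists_isMajorant hu
  have hx1 : ‖x‖ < 1 := by simpa using hx
  have hx3 : x ∈ ball (0 : EuclideanSpace ℝ (Fin n)) 3 := by simp; linarith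
  -- A majorant is nonnegative at `x - b/‖b‖`, which lies in `B₂`. Its value there is its value at
  -- `x` minus `‖b‖`, so the competitors below the constant `c` at `x` form a compact set.
  have hbound : ∀ a b, IsMajorant u a b → a + inner ℝ b x ≤ c → ‖b‖ ≤ c := by
    intro a b hab hle
    rcases eq_or_ne b 0 with rfl | hb
    · simpa using hc0
    have hb' : 0 < ‖b‖ := norm_pos_iff.2 hb
    have hw : ‖‖b‖⁻¹ • b‖ = 1 := by
      rw [norm_smul, norm_inv, norm_norm, inv_mul_cancel₀ hb'.ne']
    have hy : x - ‖b‖⁻¹ • b ∈ ball (0 : EuclideanSpace ℝ (Fin n)) 3 := by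
      rw [mem_ball_zero_iff]
      have := norm_sub_le x (‖b‖⁻¹ • b)
      linarith
    have h0 := (le_max_right _ _).trans (hab _ hy)
    rw [inner_sub_right, inner_smul_right, real_inner_self_eq_norm_sq, sq, ← mul_assoc,
      inv_mul_cancel₀ hb'.ne', one_mul] at h0
    linarith
  have hcpt : IsCompact ({q : ℝ × EuclideanSpace ℝ (Fin n) | IsMajorant u q.1 q.2} ∩
      {q | q.1 + inner ℝ q.2 x ≤ c}) := by
    have hcl : IsClosed {q : ℝ × EuclideanSpace ℝ (Fin n) | q.1 + inner ℝ q.2 x ≤ c} :=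
      isClosed_le (by fun_prop) continuous_const
    refine IsCompact.of_isClosed_subset
      ((isCompact_Icc (a := 0) (b := 2 * c)).prod (isCompact_closedBall
        (0 : EuclideanSpace ℝ (Fin n)) c)) (isClosed_setOf_isMajorant.inter hcl) ?_
    rintro ⟨a, b⟩ ⟨hab, hle⟩
    have hb := hbound a b hab hle
    simp only [Set.mem_ofPred_eq] at hab hle
    have h0 := (le_max_right _ _).trans (hab 0 (by simp))
    simp only [inner_zero_right, add_zero] at h0
    have h1 := (abs_le.1 (abs_real_inner_le_norm b x)).1
    have h2 : ‖b‖ * ‖x‖ ≤ c * 1 := by gcongr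
    exact ⟨⟨h0, by linarith⟩, by simpa using hb⟩
  obtain ⟨⟨a, b⟩, ⟨hab, hle⟩, hmin⟩ := hcpt.exists_isMinOn (f := fun q => q.1 + inner ℝ q.2 x)
    ⟨(c, 0), hc, by simp⟩ (by fun_prop)
  refine ⟨a, b, hab, le_antisymm ?_ (NonlocalABP.concaveEnvelope_le hab hx3)⟩
  refine le_concaveEnvelope hu hx3 fun a' b' hab' => ?_
  rcases le_total (a' + inner ℝ b' x) c with h | h
  · exact hmin (show (a', b') ∈ _ from ⟨hab', h⟩)
  · exact le_trans hle h

theorem exists_isSupportingAt (hu : BddAbove (Set.range u)) {x : EuclideanSpace ℝ (Fin n)}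
    (hx : x ∈ contactSet u) : ∃ p, IsSupportingAt u x p := by
  obtain ⟨a, b, hab, he⟩ := exists_isMajorant_eq hu hx.2
  refine ⟨b, fun y hy => ?_⟩
  have h1 : u x = concaveEnvelope u x := hx.1
  rw [h1, ← he, inner_sub_right]
  linarith [hab y hy]

/-- The radius 3 is what makes this work: for `‖z‖ < 2` both `x ± z` lie in `B₃`, below the plane,
and for `‖z‖ ≥ 2` both lie outside `B₁`, where `u ≤ 0 ≤ u x`. The mixed case never occurs. -/
theorem IsSupportingAt.secondDiff_nonpos {x p : EuclideanSpace ℝ (Fin n)}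
    (h : IsSupportingAt u x p) (hx : x ∈ ball 0 1)
    (hout : ∀ y ∉ ball (0 : EuclideanSpace ℝ (Fin n)) 1, u y ≤ 0)
    (z : EuclideanSpace ℝ (Fin n)) : secondDiff u x z ≤ 0 := by
  have hx1 : ‖x‖ < 1 := by simpa using hx
  have hx3 : x ∈ ball (0 : EuclideanSpace ℝ (Fin n)) 3 := by simp; linarith
  have hux : 0 ≤ u x := by simpa using (le_max_right _ _).trans (h x hx3)
  have key : ‖x + z‖ < 3 ∧ ‖x - z‖ < 3 ∨ 1 ≤ ‖x + z‖ ∧ 1 ≤ ‖x - z‖ := by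
    have h1 : ‖z‖ ≤ ‖x + z‖ + ‖x‖ := by simpa using norm_sub_le (x + z) x
    have h2 : ‖z‖ ≤ ‖x‖ + ‖x - z‖ := by simpa using norm_sub_le x (x - z)
    have h3 := norm_add_le x z
    have h4 := norm_sub_le x z
    rcases lt_or_ge ‖z‖ 2 with hz | hz
    · left; constructor <;> linarith
    · right; constructor <;> linarith
  unfold secondDiff
  rcases key with ⟨h1, h2⟩ | ⟨h1, h2⟩
  · have e1 := (le_max_left _ _).trans (h (x + z) (by simpa using h1))
    have e2 := (le_max_left _ _).trans (h (x - z) (by simpa using h2))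
    simp only [add_sub_cancel_left, sub_sub_cancel_left, inner_neg_right] at e1 e2
    linarith
  · have e1 := hout (x + z) (by simpa using h1)
    have e2 := hout (x - z) (by simpa using h2)
    linarith

theorem bddAbove_range (husc : UpperSemicontinuousOn u (closure (ball 0 1)))
    (hout : ∀ y ∉ ball (0 : EuclideanSpace ℝ (Fin n)) 1, u y ≤ 0) : BddAbove (Set.range u) := by
  rw [closure_ball _ one_ne_zero] at husc
  obtain ⟨z, -, hz⟩ := husc.exists_isMaxOn (nonempty_closedBall.2 zero_le_one)
    (isCompact_closedBall _ _)
  refine ⟨max (u z) 0, ?_⟩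
  rintro _ ⟨y, rfl⟩
  by_cases hy : y ∈ ball (0 : EuclideanSpace ℝ (Fin n)) 1
  · exact le_max_of_le_left (hz (ball_subset_closedBall hy))
  · exact le_max_of_le_right (hout y hy)

/-! ### The maximum principle for a given covering. -/

/-- Every small slope is the slope of a supporting affine function at some contact point. -/
theorem ball_subset_gradImage (husc : UpperSemicontinuousOn u (closure (ball 0 1)))
    (hout : ∀ y ∉ ball (0 : EuclideanSpace ℝ (Fin n)) 1, u y ≤ 0)
    {x₀ : EuclideanSpace ℝ (Fin n)} (hx₀ : x₀ ∈ ball 0 1) :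
    ball 0 (u x₀ / 4) ⊆ gradImage (concaveEnvelope u) (contactSet u) := by
  have hbdd := bddAbove_range husc hout
  intro p hp
  have hp' : ‖p‖ < u x₀ / 4 := by simpa using hp
  rw [closure_ball _ one_ne_zero] at husc
  have husc' : UpperSemicontinuousOn (fun y => u y + -inner ℝ p y) (closedBall 0 1) :=
    husc.add (ContinuousOn.upperSemicontinuousOn (by fun_prop))
  obtain ⟨z, hz1, hz⟩ := husc'.exists_isMaxOn (nonempty_closedBall.2 zero_le_one)
    (isCompact_closedBall _ _)
  have hz1' : ‖z‖ ≤ 1 := by simpa using hz1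
  have hx1 : ‖x₀‖ < 1 := by simpa using hx₀
  have hzx : u x₀ + -inner ℝ p x₀ ≤ u z + -inner ℝ p z := hz (ball_subset_closedBall hx₀)
  have i1 := abs_le.1 (abs_real_inner_le_norm p x₀)
  have j1 : ‖p‖ * ‖x₀‖ ≤ ‖p‖ * 1 := by gcongr
  -- The factor 4 splits as 1 + 3: one `‖p‖` is lost between `x₀` and the origin, and the other
  -- three keep the plane through `(z, u z)` nonnegative in all of `B₃`.
  have hbig : 3 * ‖p‖ < u z - inner ℝ p z := by linarith
  have hzb : z ∈ ball (0 : EuclideanSpace ℝ (Fin n)) 1 := by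
    by_contra hcon
    have i2 := abs_le.1 (abs_real_inner_le_norm p z)
    have j2 : ‖p‖ * ‖z‖ ≤ ‖p‖ * 1 := by gcongr
    have := hout z hcon
    linarith [norm_nonneg p]
  have hsup : IsSupportingAt u z p := by
    intro y hy
    have hy3 : ‖y‖ < 3 := by simpa using hy
    have i2 := abs_le.1 (abs_real_inner_le_norm p y)
    have j2 : ‖p‖ * ‖y‖ ≤ ‖p‖ * 3 := by gcongr
    have h0 : 0 ≤ u z + inner ℝ p (y - z) := by
      rw [inner_sub_right]; linarith
    refine max_le ?_ h0
    by_cases hyb : y ∈ ball (0 : EuclideanSpace ℝ (Fin n)) 1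
    · have : u y + -inner ℝ p y ≤ u z + -inner ℝ p z := hz (ball_subset_closedBall hyb)
      rw [inner_sub_right]; linarith
    · exact (hout y hyb).trans h0
  have hz3 : z ∈ ball (0 : EuclideanSpace ℝ (Fin n)) 3 := by simp; linarith
  have hzeq : u z = concaveEnvelope u z := by
    refine le_antisymm ((le_max_left _ _).trans (max_le_concaveEnvelope hbdd hz3)) ?_
    simpa using hsup.concaveEnvelope_le hz3
  refine ⟨z, ⟨⟨hzeq, hzb⟩, hz3⟩, fun y hy => ?_⟩
  rw [← hzeq]
  exact hsup.concaveEnvelope_le hy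

theorem le_cubeSup (hf : ContinuousOn f (closedBall 0 1)) {c x : EuclideanSpace ℝ (Fin n)} {s : ℝ}
    (hx : x ∈ closure (openCube c s)) (hx1 : x ∈ closedBall 0 1) : f x ≤ cubeSup f c s := by
  refine le_csSup ?_ ⟨x, ⟨hx, hx1⟩, rfl⟩
  exact ((isCompact_closedBall _ _).bddAbove_image hf).mono (Set.image_mono Set.inter_subset_right)

theorem cubeSup_nonneg (hf : ContinuousOn f (closedBall 0 1))
    (hf0 : ∀ x ∈ closedBall (0 : EuclideanSpace ℝ (Fin n)) 1, 0 ≤ f x)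
    {c : EuclideanSpace ℝ (Fin n)} {s : ℝ}
    (h : (contactSet u ∩ closure (openCube c s)).Nonempty) : 0 ≤ cubeSup f c s := by
  obtain ⟨x, hx, hxc⟩ := h
  have hx1 := ball_subset_closedBall hx.2
  exact (hf0 x hx1).trans (le_cubeSup hf hxc hx1)

/-- The maximum principle, given a cube covering. -/
theorem sSup_le_of_isCubeCovering (hn : 1 ≤ n)
    (husc : UpperSemicontinuousOn u (closure (ball 0 1)))
    (hout : ∀ y ∉ ball (0 : EuclideanSpace ℝ (Fin n)) 1, u y ≤ 0)
    (hf : ContinuousOn f (closedBall 0 1))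
    (hf0 : ∀ x ∈ closedBall (0 : EuclideanSpace ℝ (Fin n)) 1, 0 ≤ f x)
    {m : ℕ} {c : Fin m → EuclideanSpace ℝ (Fin n)} {s : Fin m → ℝ} {D C₂ ν η : ℝ} (hC₂ : 0 ≤ C₂)
    (hcov : IsCubeCovering u f D C₂ ν η c s) :
    BddAbove ((fun x => max (u x) 0) '' ball 0 1) ∧
      sSup ((fun x => max (u x) 0) '' ball 0 1) ≤
        4 * (C₂ / (volume (ball (0 : EuclideanSpace ℝ (Fin n)) 1)).toReal) ^ (1 / (n : ℝ)) *
          (∑ j, cubeSup f (c j) (s j) ^ n *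
            (volume (openCube (c j) (s j))).toReal) ^ (1 / (n : ℝ)) := by
  have hbdd := bddAbove_range husc hout
  have : Nonempty (Fin n) := ⟨⟨0, hn⟩⟩
  set ω := (volume (ball (0 : EuclideanSpace ℝ (Fin n)) 1)).toReal with hω
  have hω0 : 0 < ω := ENNReal.toReal_pos (measure_ball_pos _ _ one_pos).ne' measure_ball_lt_top.ne
  set S := ∑ j, cubeSup f (c j) (s j) ^ n * (volume (openCube (c j) (s j))).toReal with hS
  have hS0 : 0 ≤ S := Finset.sum_nonneg fun j _ =>
    mul_nonneg (pow_nonneg (cubeSup_nonneg hf hf0 (hcov.meets j)) _) ENNReal.toReal_nonneg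
  constructor
  · obtain ⟨M, hM⟩ := hbdd
    refine ⟨max M 0, ?_⟩
    rintro _ ⟨y, -, rfl⟩
    exact max_le_max (hM ⟨y, rfl⟩) le_rfl
  refine csSup_le ((nonempty_ball.2 one_pos).image _) ?_
  rintro _ ⟨x, hx, rfl⟩
  refine max_le ?_ (by positivity)
  rcases le_or_gt (u x) 0 with hux | hux
  · exact hux.trans (by positivity)
  have hfin : ∀ j, volume (openCube (c j) (s j)) ≠ ⊤ := fun j => by
    have : Bornology.IsBounded (openCube (c j) (s j)) := by
      have := (Bornology.IsBounded.pi (fun i => isBounded_ball (x := c j i) (r := s j / 2)))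
      have h2 := (EuclideanSpace.equiv (Fin n) ℝ).symm.lipschitz.isBounded_image this
      refine h2.subset fun y hy => ⟨_, ?_, (EuclideanSpace.equiv (Fin n) ℝ).symm_apply_apply y⟩
      intro i _
      simpa [Real.dist_eq] using hy i
    exact this.measure_lt_top.ne
  have hvol : ENNReal.ofReal ((u x / 4) ^ n * ω) ≤ ENNReal.ofReal (C₂ * S) := by
    calc ENNReal.ofReal ((u x / 4) ^ n * ω)
        = volume (ball (0 : EuclideanSpace ℝ (Fin n)) (u x / 4)) := by
          rw [Measure.addHaar_ball _ _ (by positivity), ENNReal.ofReal_mul (by positivity), hω,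
            ENNReal.ofReal_toReal measure_ball_lt_top.ne, finrank_euclideanSpace_fin]
      _ ≤ volume (⋃ j, gradImage (concaveEnvelope u) (closure (openCube (c j) (s j)))) := by
          refine measure_mono ((ball_subset_gradImage husc hout hx).trans ?_)
          rintro p ⟨y, ⟨hy, hy3⟩, hp⟩
          obtain ⟨j, hj⟩ := Set.mem_iUnion.1 (hcov.covers hy)
          exact Set.mem_iUnion.2 ⟨j, y, ⟨hj, hy3⟩, hp⟩
      _ ≤ ∑ j, volume (gradImage (concaveEnvelope u) (closure (openCube (c j) (s j)))) :=
          measure_iUnion_fintype_le _ _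
      _ ≤ ∑ j, ENNReal.ofReal (C₂ * (cubeSup f (c j) (s j) ^ n *
            (volume (openCube (c j) (s j))).toReal)) := by
          refine Finset.sum_le_sum fun j _ => (hcov.gradient j).trans_eq ?_
          have := cubeSup_nonneg hf hf0 (hcov.meets j)
          rw [← mul_assoc, ENNReal.ofReal_mul (p := C₂ * _) (by positivity),
            ENNReal.ofReal_toReal (hfin j)]
      _ = ENNReal.ofReal (C₂ * S) := by
          rw [hS, Finset.mul_sum, ENNReal.ofReal_sum_of_nonneg]
          intro j _
          have := cubeSup_nonneg hf hf0 (hcov.meets j)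
          positivity
  rw [ENNReal.ofReal_le_ofReal_iff (by positivity)] at hvol
  have h1 : (u x / 4) ^ n ≤ C₂ / ω * S := by
    rw [div_mul_eq_mul_div, le_div_iff₀ hω0]; exact hvol
  have h2 := Real.rpow_le_rpow (z := 1 / (n : ℝ)) (by positivity) h1 (by positivity)
  rw [one_div, Real.pow_rpow_inv_natCast (by positivity) (by omega),
    Real.mul_rpow (by positivity) hS0] at h2
  rw [one_div]
  linarith

/-! ### The equation at a contact point. -/

theorem lintegral_norm_sq_div_rpow_lt_top (hn : 1 ≤ n) {α ε : ℝ} (hα : α < 2) :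
    ∫⁻ h in ball (0 : EuclideanSpace ℝ (Fin n)) ε,
      ENNReal.ofReal (‖h‖ ^ 2 / ‖h‖ ^ ((n : ℝ) + α)) < ⊤ := by
  have : Nonempty (Fin n) := ⟨⟨0, hn⟩⟩
  refine Integrable.lintegral_lt_top ?_
  have := (integrableOn_fun_norm_addHaar (F := ℝ)
    (volume : Measure (EuclideanSpace ℝ (Fin n)))
    (f := fun t => t ^ 2 / t ^ ((n : ℝ) + α)) (r := ε)).2
  refine this ?_
  rw [finrank_euclideanSpace_fin]
  rcases le_or_gt ε 0 with hε | hε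
  · simp [Set.Ioo_eq_empty (not_lt.2 hε)]
  -- In polar coordinates the integrand is `t^(n-1) t^(2-n-α) = t^(1-α)`, integrable at 0 because `α
  -- < 2`.
  have h1 : IntegrableOn (fun t : ℝ => t ^ (1 - α)) (Set.Ioo 0 ε) :=
    (intervalIntegral.integrableOn_Ioo_rpow_iff hε).2 (by linarith)
  refine h1.congr_fun (fun t ht => ?_) measurableSet_Ioo
  have ht0 : 0 < t := ht.1
  simp only [smul_eq_mul]
  rw [← Real.rpow_natCast t (n - 1), ← Real.rpow_natCast t 2, ← Real.rpow_sub ht0,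
    ← Real.rpow_add ht0, Nat.cast_sub hn]
  congr 1
  push_cast
  ring

/-- `P` and `N` are the integrals of the positive and negative parts in `linOp`. An infinite `N`
would make the difference `-∞`, so a finite lower bound controls `N`. -/
theorem lt_of_neg_lt_sub {P N : ℝ≥0∞} {a M : ℝ} (hP : P ≤ ENNReal.ofReal a) (ha : 0 ≤ a)
    (h : ((-M : ℝ) : EReal) < (P : EReal) - (N : EReal)) : N ≤ ENNReal.ofReal (a + M) := by
  have hPt : P ≠ ⊤ := (hP.trans_lt ENNReal.ofReal_lt_top).ne
  have hNt : N ≠ ⊤ := by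
    rintro rfl
    simp at h
  lift P to NNReal using hPt
  lift N to NNReal using hNt
  have hP' : (P : ℝ) ≤ a := by
    have := ENNReal.toReal_mono ENNReal.ofReal_ne_top hP
    rwa [ENNReal.toReal_ofReal ha] at this
  have h' : -M < (P : ℝ) - N := by
    have e1 : (((P : ℝ≥0∞)) : EReal) = ((P : ℝ) : EReal) := rfl
    have e2 : (((N : ℝ≥0∞)) : EReal) = ((N : ℝ) : EReal) := rfl
    rw [e1, e2, ← EReal.coe_sub] at h
    exact EReal.coe_lt_coe_iff.1 h
  rw [← ENNReal.ofReal_coe_nnreal]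
  exact ENNReal.ofReal_le_ofReal (by linarith)

open Classical in
/-- At a contact point the second differences of `u` are integrable against the lower bound of
some kernel, with an upper bound given by the right-hand side of the equation. -/
theorem exists_lintegral_secondDiff_le (hn : 1 ≤ n) {δ lam Lam α : ℝ} (hlam : 0 < lam)
    (hLam : lam ≤ Lam) (hα : α < 2)
    (hvisc : IsViscositySubsolution δ lam Lam α (ball 0 1) u f)
    (hout : ∀ y ∉ ball (0 : EuclideanSpace ℝ (Fin n)) 1, u y ≤ 0)
    {x p : EuclideanSpace ℝ (Fin n)} (hx : x ∈ ball 0 1) (hp : IsSupportingAt u x p)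
    {M ε : ℝ} (hM : f x < M) (hε : 0 < ε) (hball : ball x ε ⊆ ball 0 1) :
    ∃ ξ : EuclideanSpace ℝ (Fin n), ‖ξ‖ = 1 ∧
      ∫⁻ h, ({h | ε ≤ ‖h‖} ∩ sector δ ξ).indicator (fun h =>
        ENNReal.ofReal (lam * (2 - α) / ‖h‖ ^ ((n : ℝ) + α) * -secondDiff u x h)) h ≤
      ENNReal.ofReal M := by
  have hα' : 0 < 2 - α := by linarith
  have hLam0 : 0 < Lam := hlam.trans_le hLam
  have hAtop := lintegral_norm_sq_div_rpow_lt_top (α := α) (ε := ε) hn hα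
  set A := (∫⁻ h in ball (0 : EuclideanSpace ℝ (Fin n)) ε,
      ENNReal.ofReal (‖h‖ ^ 2 / ‖h‖ ^ ((n : ℝ) + α))).toReal with hA
  have hA0 : 0 ≤ A := ENNReal.toReal_nonneg
  -- The bending `κ` is so small that the positive part of the integral is at most `(M - f x)/2`. It
  -- absorbs `Lam`, so the final bound does not depend on `Lam`.
  set κ := (M - f x) / (4 * (Lam * (2 - α)) * (A + 1)) with hκ
  have hκ0 : 0 < κ := div_pos (by linarith) (by positivity)
  have hκA : 2 * κ * (Lam * (2 - α)) * A ≤ (M - f x) / 2 := by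
    have : 2 * κ * (Lam * (2 - α)) * (A + 1) = (M - f x) / 2 := by
      rw [hκ]; field_simp; ring
    rw [← this]
    gcongr
    linarith
  set φ : EuclideanSpace ℝ (Fin n) → ℝ :=
    fun y => u x + inner ℝ p (y - x) + κ * ‖y - x‖ ^ 2 with hφ
  set v := (ball x ε).piecewise φ u with hv
  have hsub : ball (0 : EuclideanSpace ℝ (Fin n)) 1 ⊆ ball 0 3 := ball_subset_ball (by norm_num)
  have hvle := hvisc.2 x hx (ball x ε) isOpen_ball (mem_ball_self hε) hball φ
    (ContDiff.contDiffOn (by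
      refine (contDiff_const.add (contDiff_const.inner ℝ (contDiff_id.sub contDiff_const))).add
        (contDiff_const.mul ?_)
      exact (contDiff_id.sub contDiff_const).norm_sq ℝ))
    (by simp [hφ]) (fun y hy hyx => by
      have h1 := (le_max_left _ _).trans (hp y (hsub (hball hy)))
      have h2 : 0 < ‖y - x‖ := norm_pos_iff.2 (sub_ne_zero.2 hyx)
      have : 0 < κ * ‖y - x‖ ^ 2 := by positivity
      simp only [hφ]
      linarith)
  have hvx : v x = u x := by
    rw [hv, Set.piecewise_eq_of_mem _ _ _ (mem_ball_self hε)]; simp [hφ]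
  have hsd_in : ∀ h, ‖h‖ < ε → secondDiff v x h = 2 * κ * ‖h‖ ^ 2 := by
    intro h hh
    unfold secondDiff
    rw [hvx, hv, Set.piecewise_eq_of_mem _ _ _ (by simpa using hh),
      Set.piecewise_eq_of_mem _ _ _ (by simpa [mem_ball, dist_eq_norm] using hh)]
    simp only [hφ, add_sub_cancel_left, sub_sub_cancel_left, inner_neg_right, norm_neg]
    ring
  have hsd_out : ∀ h, ε ≤ ‖h‖ → secondDiff v x h = secondDiff u x h := by
    intro h hh
    unfold secondDiff
    rw [hvx, hv, Set.piecewise_eq_of_notMem _ _ _ (by simpa using hh),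
      Set.piecewise_eq_of_notMem _ _ _ (by simpa [mem_ball, dist_eq_norm] using hh)]
  -- The supremum over kernels need not be attained. The other half of the gap between `f x` and `M`
  -- pays for a nearly optimal kernel.
  have hlt : ((-((M + f x) / 2) : ℝ) : EReal) < maxOp δ lam Lam α v x :=
    lt_of_lt_of_le (EReal.coe_lt_coe_iff.2 (by linarith)) hvle
  rw [maxOp, lt_iSup_iff] at hlt
  obtain ⟨K, hlt⟩ := hlt
  rw [lt_iSup_iff] at hlt
  obtain ⟨⟨-, -, ξ, hξ, hK⟩, hlt⟩ := hlt
  refine ⟨ξ, hξ, ?_⟩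
  have hK0 : ∀ h, h ≠ 0 → 0 ≤ K h := fun h hh =>
    (Set.indicator_nonneg (fun z _ => by positivity) h).trans (hK h hh).1
  have hpos : ∫⁻ h, ENNReal.ofReal (secondDiff v x h * K h) ≤
      ENNReal.ofReal ((M - f x) / 2) := by
    calc ∫⁻ h, ENNReal.ofReal (secondDiff v x h * K h)
        ≤ ∫⁻ h, (ball (0 : EuclideanSpace ℝ (Fin n)) ε).indicator (fun h =>
            ENNReal.ofReal (2 * κ * (Lam * (2 - α))) *
              ENNReal.ofReal (‖h‖ ^ 2 / ‖h‖ ^ ((n : ℝ) + α))) h := by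
          refine lintegral_mono fun h => ?_
          by_cases hh : ‖h‖ < ε
          · rw [Set.indicator_of_mem (by simpa using hh), ← ENNReal.ofReal_mul (by positivity),
              hsd_in h hh]
            apply ENNReal.ofReal_le_ofReal
            -- The value `K 0` is not controlled, but the second difference vanishes there.
            rcases eq_or_ne h 0 with rfl | h0
            · simp
            · calc 2 * κ * ‖h‖ ^ 2 * K h
                  ≤ 2 * κ * ‖h‖ ^ 2 * (Lam * (2 - α) / ‖h‖ ^ ((n : ℝ) + α)) := by
                    gcongr
                    exact (hK h h0).2
                _ = _ := by ring
          · rw [hsd_out h (not_lt.1 hh)]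
            have h0 : h ≠ 0 := by
              rintro rfl
              simp [hε] at hh
            have := mul_nonpos_of_nonpos_of_nonneg (hp.secondDiff_nonpos hx hout h) (hK0 h h0)
            simp [ENNReal.ofReal_of_nonpos this]
      _ = ENNReal.ofReal (2 * κ * (Lam * (2 - α))) * ENNReal.ofReal A := by
          rw [lintegral_indicator measurableSet_ball, lintegral_const_mul' _ _ (by simp), hA,
            ENNReal.ofReal_toReal hAtop.ne]
      _ ≤ ENNReal.ofReal ((M - f x) / 2) := by
          rw [← ENNReal.ofReal_mul (by positivity)]
          exact ENNReal.ofReal_le_ofReal hκA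
  have hneg := lt_of_neg_lt_sub hpos (by linarith) hlt
  rw [show (M - f x) / 2 + (M + f x) / 2 = M by ring] at hneg
  refine le_trans (lintegral_mono fun h => ?_) hneg
  by_cases hh : h ∈ {h | ε ≤ ‖h‖} ∩ sector δ ξ
  · rw [Set.indicator_of_mem hh, hsd_out h hh.1]
    apply ENNReal.ofReal_le_ofReal
    have h0 : h ≠ 0 := by
      rintro rfl
      have := hh.1
      simp at this
      linarith
    have h1 := (hK h h0).1
    rw [Set.indicator_of_mem hh.2] at h1
    have h2 := hp.secondDiff_nonpos hx hout h
    nlinarith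
  · rw [Set.indicator_of_notMem hh]
    exact zero_le

/-! ### Selection of a dyadic ring. -/

theorem aemeasurable_comp_add (hu : AEMeasurable u) (x : EuclideanSpace ℝ (Fin n)) :
    AEMeasurable fun h => u (x + h) :=
  hu.comp_quasiMeasurePreserving (measurePreserving_add_left volume x).quasiMeasurePreserving

theorem aemeasurable_secondDiff (hu : AEMeasurable u) (x : EuclideanSpace ℝ (Fin n)) :
    AEMeasurable fun h => secondDiff u x h := by
  have h1 := aemeasurable_comp_add hu x
  have h2 : AEMeasurable fun h => u (x - h) := by
    have := h1.comp_quasiMeasurePreserving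
      (Measure.measurePreserving_neg volume).quasiMeasurePreserving
    simpa [Function.comp_def, ← sub_eq_add_neg] using this
  unfold secondDiff
  exact (h1.add h2).sub aemeasurable_const

/-- A ball around `¾ r ξ` lies in the double cone with axis `ξ` and in the ring `r/2 < |h| < r`. -/
theorem mem_sector_of_mem_ball {δ l r : ℝ} (hδ : 0 < δ) (hδ' : δ < 1) (hl : l = (1 - δ) / 8)
    (hr : 0 < r) {ξ h : EuclideanSpace ℝ (Fin n)} (hξ : ‖ξ‖ = 1)
    (hh : h ∈ ball ((3 / 4 * r) • ξ) (2 * l * r)) :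
    h ∈ sector δ ξ ∧ r / 2 < ‖h‖ ∧ ‖h‖ < r := by
  rw [mem_ball, dist_eq_norm] at hh
  have hn1 : ‖(3 / 4 * r) • ξ‖ = 3 / 4 * r := by
    rw [norm_smul, hξ, Real.norm_of_nonneg (by positivity), mul_one]
  have h2l : 2 * l * r < 1 / 4 * r := by
    have : 2 * l < 1 / 4 := by linarith
    gcongr
  have hup : ‖h‖ < 3 / 4 * r + 2 * l * r := by
    have := norm_le_norm_add_norm_sub' h ((3 / 4 * r) • ξ)
    linarith
  have hlow : 3 / 4 * r - 2 * l * r < ‖h‖ := by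
    have := norm_le_norm_add_norm_sub h ((3 / 4 * r) • ξ)
    rw [hn1] at this
    linarith
  have hpos : 0 < ‖h‖ := by linarith
  refine ⟨?_, by linarith, by linarith⟩
  have hin : 3 / 4 * r - 2 * l * r < inner ℝ h ξ := by
    have h1 : inner ℝ h ξ = 3 / 4 * r + inner ℝ (h - (3 / 4 * r) • ξ) ξ := by
      rw [inner_sub_left, inner_smul_left, real_inner_self_eq_norm_sq, hξ]
      simp
    have h2 := (abs_le.1 (abs_real_inner_le_norm (h - (3 / 4 * r) • ξ) ξ)).1
    rw [hξ, mul_one] at h2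
    linarith
  rw [sector, Set.mem_ofPred_eq, real_inner_smul_left]
  refine le_trans ?_ (le_abs_self _)
  rw [← div_eq_inv_mul, le_div_iff₀ hpos]
  have h3 : δ * ‖h‖ ≤ δ * (3 / 4 * r + 2 * l * r) := by gcongr
  -- With `l = (1 - δ)/8` this reduces to `1 + δ ≤ 3`.
  have h4 : δ * (3 / 4 * r + 2 * l * r) ≤ 3 / 4 * r - 2 * l * r := by
    rw [hl]; nlinarith [mul_pos hr (sub_pos.2 hδ'), mul_pos hδ (sub_pos.2 hδ')]
  linarith

/-- The terms are `ρ^(2-α)/2 · q^k` with `q = 2^(-(2-α))`, and `1 - q ≤ 2 - α`. So the factor `2 -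
α` cancels the blow-up of the geometric sum as `α → 2`, and the shrinking of the first radius costs
only a factor 1/2. Stopping at `q^K < 1/2` costs another 1/2. -/
theorem exists_le_sum_rpow {ρ α : ℝ} (hρ : 0 < ρ) (hρ1 : ρ ≤ 1) (hα0 : 0 < α) (hα : α < 2) :
    ∃ K : ℕ, ρ ^ 2 / 4 ≤ (2 - α) *
      ∑ k ∈ Finset.range K, (ρ * (2 : ℝ) ^ (-1 / (2 - α)) / 2 ^ k) ^ (2 - α) := by
  have hα' : 0 < 2 - α := by linarith
  set q : ℝ := (2 : ℝ) ^ (-(2 - α)) with hq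
  have hq0 : 0 < q := by positivity
  have hq1 : q < 1 := Real.rpow_lt_one_of_one_lt_of_neg one_lt_two (by linarith)
  have hq2 : 1 - q ≤ 2 - α := by
    have h1 : q = Real.exp (Real.log 2 * (-(2 - α))) := Real.rpow_def_of_pos two_pos _
    have h2 := Real.add_one_le_exp (Real.log 2 * (-(2 - α)))
    have h3 : Real.log 2 ≤ 1 := by linarith [Real.log_two_lt_d9]
    nlinarith
  obtain ⟨K, hK⟩ := exists_pow_lt_of_lt_one (show (0 : ℝ) < 1 / 2 by norm_num) hq1
  refine ⟨K, ?_⟩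
  have hterm : ∀ k : ℕ, (ρ * (2 : ℝ) ^ (-1 / (2 - α)) / 2 ^ k) ^ (2 - α) =
      ρ ^ (2 - α) / 2 * q ^ k := by
    intro k
    have e1 : ((2 : ℝ) ^ (-1 / (2 - α))) ^ (2 - α) = 2⁻¹ := by
      rw [← Real.rpow_mul (by norm_num), div_mul_cancel₀ _ hα'.ne', Real.rpow_neg_one]
    have e2 : ((2 : ℝ) ^ k) ^ (2 - α) = (q ^ k)⁻¹ := by
      rw [hq, Real.rpow_neg (by norm_num), inv_pow, inv_inv, ← Real.rpow_natCast,
        ← Real.rpow_natCast, ← Real.rpow_mul (by norm_num), ← Real.rpow_mul (by norm_num),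
        mul_comm]
    rw [Real.div_rpow (by positivity) (by positivity), Real.mul_rpow hρ.le (by positivity),
      e1, e2, div_inv_eq_mul, div_eq_mul_inv]
  have h2 : ρ ^ 2 ≤ ρ ^ (2 - α) := by
    rw [← Real.rpow_natCast]
    exact Real.rpow_le_rpow_of_exponent_ge hρ hρ1 (by push_cast; linarith)
  simp_rw [hterm]
  rw [← Finset.mul_sum, geom_sum_eq hq1.ne]
  have h3 : 1 / 2 ≤ (2 - α) * ((q ^ K - 1) / (q - 1)) := by
    rw [← neg_div_neg_eq (q ^ K - 1), neg_sub, neg_sub, mul_div_assoc', le_div_iff₀ (by linarith)]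
    nlinarith
  nlinarith [mul_le_mul h2 h3 (by norm_num) (by positivity)]

/-- Among the rings of a sufficiently long dyadic sequence there is one where, in some direction,
`u` detaches at most quadratically from its supporting affine function, up to a small set. -/
theorem exists_volume_le (hn : 1 ≤ n) {δ lam Lam α l ρ ε₀ : ℝ} (hδ : 0 < δ) (hδ' : δ < 1)
    (hl : l = (1 - δ) / 8) (hlam : 0 < lam)
    (hLam : lam ≤ Lam) (hα0 : 0 < α) (hα : α < 2) (hu : AEMeasurable u)
    (hvisc : IsViscositySubsolution δ lam Lam α (ball 0 1) u f)
    (hout : ∀ y ∉ ball (0 : EuclideanSpace ℝ (Fin n)) 1, u y ≤ 0) (hρ : 0 < ρ) (hε₀ : 0 < ε₀)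
    {K : ℕ} {r : ℕ → ℝ} (hr : ∀ k, 0 < r k) (hr2 : ∀ k, r (k + 1) = r k / 2)
    (hK : ρ ^ 2 / 4 ≤ (2 - α) * ∑ k ∈ Finset.range K, r k ^ (2 - α))
    {x p : EuclideanSpace ℝ (Fin n)} (hx : x ∈ ball 0 1) (hp : IsSupportingAt u x p)
    {M : ℝ} (hM : f x < M) (hM0 : 0 < M) :
    ∃ k < K, ∃ ξ : EuclideanSpace ℝ (Fin n), ‖ξ‖ = 1 ∧
      volume (ball ((3 / 4 * r k) • ξ) (2 * l * r k) ∩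
        {h | 8 / (lam * ε₀ * ρ ^ 2) * M * r k ^ 2 < -secondDiff u x h}) ≤
      ENNReal.ofReal (ε₀ * r k ^ n) := by
  have hα' : 0 < 2 - α := by linarith
  have hx1 : ‖x‖ < 1 := by simpa using hx
  have hanti : Antitone r := antitone_nat_of_succ_le fun k => by
    rw [hr2]; linarith [hr k]
  set C := 8 / (lam * ε₀ * ρ ^ 2) with hC
  have hC0 : 0 < C := by positivity
  -- Cutting at `r K` keeps all rings with `k < K` in the domain of integration; cutting at `1 -
  -- ‖x‖` keeps the test ball in `B₁`. The direction `ξ` is the same for all rings.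
  obtain ⟨ξ, hξ, hint⟩ := exists_lintegral_secondDiff_le (ε := min (r K) (1 - ‖x‖)) hn hlam hLam
    hα hvisc hout hx hp hM (lt_min (hr K) (by linarith)) (by
      intro y hy
      rw [mem_ball, dist_eq_norm] at hy
      have h1 := hy.trans_le (min_le_right _ _)
      have h2 := norm_le_norm_add_norm_sub' y x
      rw [mem_ball_zero_iff]
      linarith)
  by_contra! hcon
  set G : EuclideanSpace ℝ (Fin n) → ℝ≥0∞ :=
    ({h | min (r K) (1 - ‖x‖) ≤ ‖h‖} ∩ sector δ ξ).indicator (fun h =>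
        ENNReal.ofReal (lam * (2 - α) / ‖h‖ ^ ((n : ℝ) + α) * -secondDiff u x h)) with hG
  set bad : ℕ → Set (EuclideanSpace ℝ (Fin n)) := fun k =>
    ball ((3 / 4 * r k) • ξ) (2 * l * r k) ∩ {h | C * M * r k ^ 2 < -secondDiff u x h} with hbad
  have hring : ∀ k, ∀ h ∈ bad k, h ∈ sector δ ξ ∧ r k / 2 < ‖h‖ ∧ ‖h‖ < r k := fun k h hh =>
    mem_sector_of_mem_ball hδ hδ' hl (hr k) hξ hh.1
  have hnull : ∀ k, NullMeasurableSet (bad k) := fun k =>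
    measurableSet_ball.nullMeasurableSet.inter
      (nullMeasurableSet_lt aemeasurable_const (aemeasurable_secondDiff hu x).neg)
  have hdisj : Pairwise (Function.onFun Disjoint bad) := by
    rw [pairwise_disjoint_on]
    intro i j hij
    rw [Set.disjoint_left]
    intro h hi hj
    have h1 := (hring i h hi).2.1
    have h2 := (hring j h hj).2.2
    have h3 := hanti (Nat.succ_le_of_lt hij)
    rw [Nat.succ_eq_add_one, hr2] at h3
    linarith
  have hexp : ∀ k, r k ^ 2 * r k ^ n / r k ^ ((n : ℝ) + α) = r k ^ (2 - α) := fun k => by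
    rw [← pow_add, ← Real.rpow_natCast, ← Real.rpow_sub (hr k)]
    congr 1
    push_cast
    ring
  have hterm : ∀ k ∈ Finset.range K,
      ENNReal.ofReal (lam * (2 - α) * C * M * ε₀ * r k ^ (2 - α)) ≤ ∫⁻ h in bad k, G h := by
    intro k hk
    have hrk := hr k
    have hkK := Finset.mem_range.1 hk
    calc ENNReal.ofReal (lam * (2 - α) * C * M * ε₀ * r k ^ (2 - α))
        = ENNReal.ofReal (lam * (2 - α) / r k ^ ((n : ℝ) + α) * (C * M * r k ^ 2)) *
            ENNReal.ofReal (ε₀ * r k ^ n) := by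
          rw [← ENNReal.ofReal_mul (by positivity), ← hexp k]
          congr 1
          ring
      _ ≤ ENNReal.ofReal (lam * (2 - α) / r k ^ ((n : ℝ) + α) * (C * M * r k ^ 2)) *
            volume (bad k) := by
          gcongr
          exact (hcon k hkK ξ hξ).le
      _ = ∫⁻ _ in bad k,
            ENNReal.ofReal (lam * (2 - α) / r k ^ ((n : ℝ) + α) * (C * M * r k ^ 2)) :=
          (setLIntegral_const _ _).symm
      _ ≤ ∫⁻ h in bad k, G h := by
          refine lintegral_mono_ae ((ae_restrict_iff'₀ (hnull k)).2 (.of_forall fun h hh => ?_))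
          obtain ⟨h1, h2, h3⟩ := hring k h hh
          have h4 := hanti (Nat.succ_le_of_lt hkK)
          rw [Nat.succ_eq_add_one, hr2] at h4
          have hpos : 0 < ‖h‖ := by linarith
          have hmem : h ∈ {h | min (r K) (1 - ‖x‖) ≤ ‖h‖} ∩ sector δ ξ :=
            ⟨(min_le_left _ _).trans (show r K ≤ ‖h‖ by linarith), h1⟩
          rw [hG, Set.indicator_of_mem hmem]
          apply ENNReal.ofReal_le_ofReal
          have h5 : C * M * r k ^ 2 < -secondDiff u x h := hh.2
          have h6 : (0 : ℝ) < ‖h‖ ^ ((n : ℝ) + α) := by positivity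
          have h7 : ‖h‖ ^ ((n : ℝ) + α) ≤ r k ^ ((n : ℝ) + α) :=
            Real.rpow_le_rpow hpos.le h3.le (by positivity)
          gcongr
  have hsum : ENNReal.ofReal (2 * M) ≤ ENNReal.ofReal M := by
    calc ENNReal.ofReal (2 * M)
        ≤ ENNReal.ofReal (∑ k ∈ Finset.range K, lam * (2 - α) * C * M * ε₀ * r k ^ (2 - α)) := by
          apply ENNReal.ofReal_le_ofReal
          rw [← Finset.mul_sum]
          -- The 8 in `C` is chosen to give `2 * M`, which contradicts the upper bound `M`.
          calc 2 * M = lam * C * M * ε₀ * (ρ ^ 2 / 4) := by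
                rw [hC]; field_simp; norm_num
            _ ≤ lam * C * M * ε₀ * ((2 - α) * ∑ k ∈ Finset.range K, r k ^ (2 - α)) := by gcongr
            _ = _ := by ring
      _ = ∑ k ∈ Finset.range K, ENNReal.ofReal (lam * (2 - α) * C * M * ε₀ * r k ^ (2 - α)) := by
          rw [ENNReal.ofReal_sum_of_nonneg]
          intro k _
          have := hr k
          positivity
      _ ≤ ∑ k ∈ Finset.range K, ∫⁻ h in bad k, G h := Finset.sum_le_sum hterm
      _ = ∫⁻ h in ⋃ k ∈ Finset.range K, bad k, G h :=
          (lintegral_biUnion_finset₀ (fun i _ j _ hij => (hdisj hij).aedisjoint)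
            (fun k _ => hnull k) _).symm
      _ ≤ ∫⁻ h, G h := setLIntegral_le_lintegral _ _
      _ ≤ ENNReal.ofReal M := hint
  rw [ENNReal.ofReal_le_ofReal_iff hM0.le] at hsum
  linarith

/-! ### Good radii. -/

/-- On the scale `r` around `x`, `u` is at most `T` below the affine function with slope `p`
through `(x, u x)` on a set of positive density, and so is the concave envelope of `u` near `x`. -/
structure IsGoodRadius (u : EuclideanSpace ℝ (Fin n) → ℝ) (x p : EuclideanSpace ℝ (Fin n))
    (l ν T r : ℝ) : Prop where
  density : ENNReal.ofReal (ν * r ^ n) ≤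
    volume {h | h ∈ ball 0 r ∧ u x + inner ℝ p h - T ≤ u (x + h)}
  envelope : ∀ y ∈ ball x (l * r), u x + inner ℝ p (y - x) - T ≤ concaveEnvelope u y

theorem IsGoodRadius.mono {x p : EuclideanSpace ℝ (Fin n)} {l ν T T' r : ℝ}
    (h : IsGoodRadius u x p l ν T r) (hT : T ≤ T') : IsGoodRadius u x p l ν T' r where
  density := h.density.trans (measure_mono fun y hy => ⟨hy.1, by linarith [hy.2]⟩)
  envelope y hy := by linarith [h.envelope y hy]

/-- The sets in `density` decrease as `T'` decreases to `T`, so continuity of the measure from above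
applies. This permits the passage from `M > f x` to `f x` itself. -/
theorem IsGoodRadius.of_forall_gt (hu : AEMeasurable u) {x p : EuclideanSpace ℝ (Fin n)}
    {l ν T r : ℝ} (h : ∀ T' > T, IsGoodRadius u x p l ν T' r) : IsGoodRadius u x p l ν T r where
  envelope y hy := by
    refine le_of_forall_pos_le_add fun ε hε => ?_
    linarith [(h (T + ε) (by linarith)).envelope y hy]
  density := by
    set E : ℕ → Set (EuclideanSpace ℝ (Fin n)) := fun j =>
      {h | h ∈ ball 0 r ∧ u x + inner ℝ p h - (T + 1 / ((j : ℝ) + 1)) ≤ u (x + h)} with hE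
    have hnull : ∀ j, NullMeasurableSet (E j) := fun j =>
      measurableSet_ball.nullMeasurableSet.inter
        (nullMeasurableSet_le (Continuous.aemeasurable (by fun_prop)) (aemeasurable_comp_add hu x))
    have hanti : Antitone E := fun i j hij y hy => by
      have : 1 / ((j : ℝ) + 1) ≤ 1 / ((i : ℝ) + 1) := by gcongr
      exact ⟨hy.1, by linarith [hy.2]⟩
    have hfin : ∃ j, volume (E j) ≠ ⊤ :=
      ⟨0, ((measure_mono fun y hy => hy.1).trans_lt measure_ball_lt_top).ne⟩
    have hlim := tendsto_measure_iInter_atTop hnull hanti hfin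
    refine (ge_of_tendsto' hlim fun j => (h (T + 1 / ((j : ℝ) + 1)) ?_).density).trans
      (measure_mono fun y hy => ?_)
    · have : 0 < 1 / ((j : ℝ) + 1) := by positivity
      linarith
    · rw [Set.mem_iInter] at hy
      refine ⟨(hy 0).1, ?_⟩
      have h1 := tendsto_one_div_add_atTop_nhds_zero_nat (𝕜 := ℝ)
      have h2 := (h1.const_add T).const_sub (u x + inner ℝ p y)
      rw [add_zero] at h2
      exact le_of_tendsto' h2 fun j => (hy j).2

/-- The gaps between the plane and `u` at `x + h` and `x - h` are both nonnegative and add up to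
minus the second difference, so off the bad set each is at most `T`. For the envelope, `x + z` is
the midpoint of `x + (w + z)` and `x - (w - z)`; if both are good points, every affine majorant is
at least the plane minus `T` there, hence also at `x + z`. -/
theorem isGoodRadius_of_volume_le (hn : 1 ≤ n) {δ l r ω T : ℝ} (hδ : 0 < δ) (hδ' : δ < 1)
    (hl : l = (1 - δ) / 8) (hω : volume (ball (0 : EuclideanSpace ℝ (Fin n)) 1) = ENNReal.ofReal ω)
    (hω0 : 0 < ω) (hr : 0 < r) (hr1 : r ≤ 1) (hbdd : BddAbove (Set.range u))
    {x p ξ : EuclideanSpace ℝ (Fin n)} (hx : x ∈ ball 0 1) (hp : IsSupportingAt u x p)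
    (hξ : ‖ξ‖ = 1)
    (hvol : volume (ball ((3 / 4 * r) • ξ) (2 * l * r) ∩ {h | T < -secondDiff u x h}) ≤
      ENNReal.ofReal (ω * l ^ n / 4 * r ^ n)) :
    IsGoodRadius u x p l (ω * l ^ n / 2) T r := by
  have : Nonempty (Fin n) := ⟨⟨0, hn⟩⟩
  have hl0 : 0 < l := by linarith
  have hx1 : ‖x‖ < 1 := by simpa using hx
  have hball : ∀ (c : EuclideanSpace ℝ (Fin n)) (s : ℝ), 0 ≤ s →
      volume (ball c s) = ENNReal.ofReal (ω * s ^ n) := fun c s hs => by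
    rw [Measure.addHaar_ball _ _ hs, hω, finrank_euclideanSpace_fin,
      ← ENNReal.ofReal_mul (by positivity), mul_comm]
  set bad := ball ((3 / 4 * r) • ξ) (2 * l * r) ∩ {h | T < -secondDiff u x h} with hbad
  have hgood : ∀ h ∈ ball ((3 / 4 * r) • ξ) (2 * l * r), h ∉ bad →
      h ∈ ball (0 : EuclideanSpace ℝ (Fin n)) r ∧ u x + inner ℝ p h - T ≤ u (x + h) ∧
        u x + inner ℝ p (-h) - T ≤ u (x - h) := by
    intro h hh hhb
    have hhr := (mem_sector_of_mem_ball hδ hδ' hl hr hξ hh).2.2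
    have h1 : -secondDiff u x h ≤ T := by
      by_contra! hcon
      exact hhb ⟨hh, hcon⟩
    have e1 := (le_max_left _ _).trans (hp (x + h) (by
      rw [mem_ball_zero_iff]; linarith [norm_add_le x h]))
    have e2 := (le_max_left _ _).trans (hp (x - h) (by
      rw [mem_ball_zero_iff]; linarith [norm_sub_le x h]))
    simp only [add_sub_cancel_left, sub_sub_cancel_left, inner_neg_right] at e1 e2
    unfold secondDiff at h1
    rw [inner_neg_right]
    exact ⟨by simpa using hhr, by linarith, by linarith⟩
  constructor
  · by_contra! hcon
    have h1 : volume (ball ((3 / 4 * r) • ξ) (2 * l * r)) <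
        ENNReal.ofReal (ω * l ^ n / 2 * r ^ n) + ENNReal.ofReal (ω * l ^ n / 4 * r ^ n) := by
      refine lt_of_le_of_lt ?_ (ENNReal.add_lt_add_of_lt_of_le
        (hvol.trans_lt ENNReal.ofReal_lt_top).ne hcon hvol)
      refine (measure_mono fun h hh => ?_).trans (measure_union_le _ _)
      by_cases hb : h ∈ bad
      · exact Or.inr hb
      · exact Or.inl ⟨(hgood h hh hb).1, (hgood h hh hb).2.1⟩
    rw [hball _ _ (by positivity), ← ENNReal.ofReal_add (by positivity) (by positivity),
      ENNReal.ofReal_lt_ofReal_iff (by positivity)] at h1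
    have h2 : l ^ n * r ^ n ≤ (2 * l * r) ^ n := by
      rw [← mul_pow]
      exact pow_le_pow_left₀ (by positivity) (by nlinarith [mul_pos hl0 hr]) n
    have h3 : 0 < ω * (l ^ n * r ^ n) := by positivity
    nlinarith [mul_le_mul_of_nonneg_left h2 hω0.le]
  · intro y hy
    rw [mem_ball, dist_eq_norm] at hy
    set z := y - x with hz
    -- The two translates of the bad set fill at most half of the volume `ω (l r)^n` of the ball in
    -- which `w` is sought.
    obtain ⟨w, hw, hwz⟩ : ∃ w ∈ ball ((3 / 4 * r) • ξ) (l * r), w + z ∉ bad ∧ w + -z ∉ bad := by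
      by_contra! hcon
      have h1 : volume (ball ((3 / 4 * r) • ξ) (l * r)) ≤
          ENNReal.ofReal (ω * l ^ n / 4 * r ^ n) + ENNReal.ofReal (ω * l ^ n / 4 * r ^ n) := by
        calc volume (ball ((3 / 4 * r) • ξ) (l * r))
            ≤ volume ((fun w => w + z) ⁻¹' bad ∪ (fun w => w + -z) ⁻¹' bad) := by
              refine measure_mono fun w hw => ?_
              by_cases hb : w + z ∈ bad
              · exact Or.inl hb
              · exact Or.inr (hcon w hw hb)
          _ ≤ _ := (measure_union_le _ _).trans (by
              rw [measure_preimage_add_right, measure_preimage_add_right]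
              exact add_le_add hvol hvol)
      rw [hball _ _ (by positivity), ← ENNReal.ofReal_add (by positivity) (by positivity),
        ENNReal.ofReal_le_ofReal_iff (by positivity), mul_pow] at h1
      have h3 : 0 < ω * (l ^ n * r ^ n) := by positivity
      linarith
    rw [mem_ball, dist_eq_norm] at hw
    have hl1 : l * r < 1 := by nlinarith
    have g1 := hgood (w + z) (by
      rw [mem_ball, dist_eq_norm, add_sub_right_comm]
      linarith [norm_add_le (w - (3 / 4 * r) • ξ) z]) hwz.1
    have g2 := hgood (w + -z) (by
      rw [mem_ball, dist_eq_norm, add_sub_right_comm]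
      have := norm_add_le (w - (3 / 4 * r) • ξ) (-z)
      rw [norm_neg] at this
      linarith) hwz.2
    have n1 : ‖w + z‖ < r := by simpa using g1.1
    have n2 : ‖w + -z‖ < r := by simpa using g2.1
    refine le_concaveEnvelope hbdd ?_ fun a b hab => ?_
    · rw [mem_ball_zero_iff]
      have := norm_le_norm_add_norm_sub' y x
      linarith
    have a1 := (le_max_left _ _).trans (hab (x + (w + z)) (by
      rw [mem_ball_zero_iff]; linarith [norm_add_le x (w + z)]))
    have a2 := (le_max_left _ _).trans (hab (x - (w + -z)) (by
      rw [mem_ball_zero_iff]; linarith [norm_sub_le x (w + -z)]))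
    have b1 := g1.2.1
    have b2 := g2.2.2
    have hyz : y = x + z := by rw [hz]; abel
    rw [hyz]
    simp only [inner_add_right, inner_sub_right, inner_neg_right] at a1 a2 b1 b2 ⊢
    linarith

/-- At every contact point one of finitely many scales is good. -/
theorem exists_isGoodRadius (hn : 1 ≤ n) {δ lam Lam α l ρ ω : ℝ} (hδ : 0 < δ) (hδ' : δ < 1)
    (hl : l = (1 - δ) / 8) (hlam : 0 < lam)
    (hLam : lam ≤ Lam) (hα0 : 0 < α) (hα : α < 2) (hu : AEMeasurable u)
    (hvisc : IsViscositySubsolution δ lam Lam α (ball 0 1) u f)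
    (hout : ∀ y ∉ ball (0 : EuclideanSpace ℝ (Fin n)) 1, u y ≤ 0)
    (hω : volume (ball (0 : EuclideanSpace ℝ (Fin n)) 1) = ENNReal.ofReal ω)
    (hω0 : 0 < ω) (hρ : 0 < ρ)
    {K : ℕ} {r : ℕ → ℝ} (hr : ∀ k, 0 < r k) (hr1 : ∀ k, r k ≤ 1) (hr2 : ∀ k, r (k + 1) = r k / 2)
    (hK : ρ ^ 2 / 4 ≤ (2 - α) * ∑ k ∈ Finset.range K, r k ^ (2 - α))
    {x : EuclideanSpace ℝ (Fin n)} (hx : x ∈ contactSet u) (hf : 0 ≤ f x) :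
    ∃ p, IsSupportingAt u x p ∧ ∃ k < K, IsGoodRadius u x p l (ω * l ^ n / 2)
      (8 / (lam * (ω * l ^ n / 4) * ρ ^ 2) * f x * r k ^ 2) (r k) := by
  have hbdd := bddAbove_range hvisc.1 hout
  have hl0 : 0 < l := by linarith
  obtain ⟨p, hp⟩ := exists_isSupportingAt hbdd hx
  refine ⟨p, hp, ?_⟩
  set C := 8 / (lam * (ω * l ^ n / 4) * ρ ^ 2) with hC
  by_contra! hcon
  -- The scale found for `M > f x` may depend on `M`. If each of the finitely many scales failed at
  -- `f x`, all would fail for a common `M` slightly larger.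
  have hev : ∀ k ∈ Finset.range K, ∀ᶠ M in nhdsWithin (f x) (Set.Ioi (f x)),
      ¬ IsGoodRadius u x p l (ω * l ^ n / 2) (C * M * r k ^ 2) (r k) := by
    intro k hk
    have hk' := hcon k (Finset.mem_range.1 hk)
    have : ∃ T > C * f x * r k ^ 2, ¬ IsGoodRadius u x p l (ω * l ^ n / 2) T (r k) := by
      by_contra! h
      exact hk' (IsGoodRadius.of_forall_gt hu h)
    obtain ⟨T, hT, hbad⟩ := this
    have hcont : Filter.Tendsto (fun M => C * M * r k ^ 2) (nhdsWithin (f x) (Set.Ioi (f x)))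
        (nhds (C * f x * r k ^ 2)) :=
      (Continuous.tendsto (by fun_prop) (f x)).mono_left nhdsWithin_le_nhds
    filter_upwards [hcont.eventually_lt_const hT] with M hM hgood
    exact hbad (hgood.mono hM.le)
  obtain ⟨M, hM, hMx⟩ := (((Filter.eventually_all_finset _).2 hev).and self_mem_nhdsWithin).exists
  have hMx' : f x < M := hMx
  obtain ⟨k, hk, ξ, hξ, hvol⟩ := exists_volume_le hn hδ hδ' hl hlam hLam hα0 hα hu hvisc hout hρ
    (ε₀ := ω * l ^ n / 4) (by positivity) hr hr2 hK hx.2 hp hMx' (hf.trans_lt hMx')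
  exact hM k (Finset.mem_range.2 hk) (isGoodRadius_of_volume_le hn hδ hδ' hl hω hω0 (hr k) (hr1 k)
    hbdd hx.2 hp hξ hvol)

/-! ### Cubes, and the two estimates on a cube of the size of a good radius. -/

theorem mem_closure_openCube {c x : EuclideanSpace ℝ (Fin n)} {s : ℝ} (hs : 0 < s)
    (hx : ∀ i, |x i - c i| ≤ s / 2) : x ∈ closure (openCube c s) := by
  have h1 := tendsto_one_div_add_atTop_nhds_zero_nat (𝕜 := ℝ)
  have h2 : Filter.Tendsto (fun j : ℕ => x - (1 / ((j : ℝ) + 1)) • (x - c)) Filter.atTop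
      (nhds x) := by
    simpa using (h1.smul_const (x - c)).const_sub x
  refine mem_closure_of_tendsto h2 (.of_forall fun j i => ?_)
  have ht0 : 0 < 1 / ((j : ℝ) + 1) := by positivity
  have ht1 : 1 / ((j : ℝ) + 1) ≤ 1 := by
    rw [div_le_one (by positivity)]
    linarith [j.cast_nonneg (α := ℝ)]
  have e : (x - (1 / ((j : ℝ) + 1)) • (x - c)) i - c i =
      (1 - 1 / ((j : ℝ) + 1)) * (x i - c i) := by
    simp only [PiLp.sub_apply, PiLp.smul_apply, smul_eq_mul]
    ring
  rw [e, abs_mul, abs_of_nonneg (by linarith)]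
  nlinarith [hx i, abs_nonneg (x i - c i)]

theorem abs_sub_le_of_mem_closure_openCube {c x : EuclideanSpace ℝ (Fin n)} {s : ℝ}
    (hx : x ∈ closure (openCube c s)) (i : Fin n) : |x i - c i| ≤ s / 2 := by
  have hcl : IsClosed {y : EuclideanSpace ℝ (Fin n) | |y i - c i| ≤ s / 2} :=
    isClosed_le (by fun_prop) continuous_const
  exact closure_minimal (fun y hy => (hy i).le) hcl hx

theorem norm_sub_le_of_forall_abs_sub_le {x y : EuclideanSpace ℝ (Fin n)} {s : ℝ} (hs : 0 ≤ s)
    (h : ∀ i, |x i - y i| ≤ s) : ‖x - y‖ ≤ √n * s := by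
  rw [EuclideanSpace.norm_eq]
  calc √(∑ i, ‖(x - y) i‖ ^ 2) ≤ √(∑ _i : Fin n, s ^ 2) := by
        gcongr with i
        exact h i
    _ = √n * s := by simp [Real.sqrt_sq hs]

theorem norm_sub_le_of_mem_closure_openCube {c x y : EuclideanSpace ℝ (Fin n)} {s : ℝ}
    (hs : 0 ≤ s) (hx : x ∈ closure (openCube c s)) (hy : y ∈ closure (openCube c s)) :
    ‖x - y‖ ≤ √n * s := by
  refine norm_sub_le_of_forall_abs_sub_le hs fun i => ?_
  have h1 := abs_le.1 (abs_sub_le_of_mem_closure_openCube hx i)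
  have h2 := abs_le.1 (abs_sub_le_of_mem_closure_openCube hy i)
  exact abs_le.2 ⟨by linarith, by linarith⟩

theorem diam_openCube_le (c : EuclideanSpace ℝ (Fin n)) {s : ℝ} (hs : 0 ≤ s) :
    diam (openCube c s) ≤ √n * s :=
  diam_le_of_forall_dist_le (by positivity) fun x hx y hy => by
    rw [dist_eq_norm]
    exact norm_sub_le_of_mem_closure_openCube hs (subset_closure hx) (subset_closure hy)

theorem le_diam_openCube (hn : 1 ≤ n) (c : EuclideanSpace ℝ (Fin n)) {s : ℝ} (hs : 0 < s) :
    s / 4 ≤ diam (openCube c s) := by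
  have hb : Bornology.IsBounded (openCube c s) := by
    refine isBounded_iff.2 ⟨√n * s, fun x hx y hy => ?_⟩
    rw [dist_eq_norm]
    exact norm_sub_le_of_mem_closure_openCube hs.le (subset_closure hx) (subset_closure hy)
  have h1 : c ∈ openCube c s := fun i => by simp [hs]
  have h2 : c + EuclideanSpace.single ⟨0, hn⟩ (s / 4) ∈ openCube c s := fun i => by
    simp only [PiLp.add_apply, add_sub_cancel_left, PiLp.single_apply]
    split_ifs
    · rw [abs_of_pos (by positivity)]; linarith
    · simp [hs]
  have h3 := dist_le_diam_of_mem hb h2 h1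
  rwa [dist_eq_norm, add_sub_cancel_left, PiLp.norm_single, Real.norm_of_nonneg (by positivity)]
    at h3

theorem volume_openCube (c : EuclideanSpace ℝ (Fin n)) {s : ℝ} (hs : 0 ≤ s) :
    volume (openCube c s) = ENNReal.ofReal (s ^ n) := by
  have h1 : openCube c s = (WithLp.ofLp) ⁻¹'
      (Set.univ.pi fun i => Set.Ioo (c i - s / 2) (c i + s / 2)) := by
    ext x
    simp only [openCube, Set.mem_ofPred_eq, Set.mem_preimage, Set.mem_univ_pi, Set.mem_Ioo, abs_lt]
    refine forall_congr' fun i => ?_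
    constructor <;> rintro ⟨h1, h2⟩ <;> constructor <;> linarith
  rw [h1, (PiLp.volume_preserving_ofLp (Fin n)).measure_preimage
    (MeasurableSet.univ_pi fun i => measurableSet_Ioo).nullMeasurableSet, volume_pi_pi]
  simp only [Real.volume_Ioo, add_sub_sub_cancel, add_halves]
  rw [Finset.prod_const, Finset.card_univ, Fintype.card_fin, ENNReal.ofReal_pow hs]

theorem mem_openCube_of_norm_lt {c x y : EuclideanSpace ℝ (Fin n)} {r s t : ℝ}
    (hx : ∀ i, |x i - c i| ≤ s / 2) (hy : ‖y - x‖ < r) (ht : r + s / 2 ≤ t / 2) :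
    y ∈ openCube c t := fun i => by
  have h1 : |y i - x i| ≤ ‖y - x‖ := PiLp.norm_apply_le (y - x) i
  have h2 := abs_sub_le (y i) (x i) (c i)
  linarith [hx i]

/-- For a slope `q` of `Γ` at a point `y` of the closed cube, move from `y` by `l r/4` in the
direction `p - q`; this stays in the ball where `Γ` is at least the plane minus `T`. Since `Γ` lies
below the plane at `y` and grows at most with slope `q`, this gives `‖p - q‖ ≤ 4T/(l r)`. -/
theorem volume_gradImage_le (hn : 1 ≤ n) {l r s ν T ω : ℝ}
    (hω : volume (ball (0 : EuclideanSpace ℝ (Fin n)) 1) = ENNReal.ofReal ω)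
    (hl : 0 < l) (hl1 : l ≤ 1) (hr : 0 < r) (hr1 : r ≤ 1) (hs : 0 ≤ s) (hsr : √n * s = l * r / 2)
    (hT : 0 ≤ T) {x p c : EuclideanSpace ℝ (Fin n)}
    (hx : x ∈ ball 0 1) (hp : IsSupportingAt u x p) (hgood : IsGoodRadius u x p l ν T r)
    (hxc : x ∈ closure (openCube c s)) :
    volume (gradImage (concaveEnvelope u) (closure (openCube c s))) ≤
      ENNReal.ofReal (ω * (4 * T / (l * r)) ^ n) := by
  have : Nonempty (Fin n) := ⟨⟨0, hn⟩⟩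
  have hlr : 0 < l * r := by positivity
  have hlr1 : l * r ≤ 1 := by nlinarith
  have hx1 : ‖x‖ < 1 := by simpa using hx
  refine (measure_mono (t := closedBall p (4 * T / (l * r))) ?_).trans_eq ?_
  · rintro q ⟨y, ⟨hy, hy3⟩, hq⟩
    rw [mem_closedBall, dist_eq_norm, le_div_iff₀ hlr]
    rcases eq_or_ne (p - q) 0 with h0 | h0
    · rw [norm_sub_rev, h0]; simpa using hT
    have hpos : 0 < ‖p - q‖ := norm_pos_iff.2 h0
    have hyx : ‖y - x‖ ≤ l * r / 2 :=
      hsr ▸ norm_sub_le_of_mem_closure_openCube hs hy hxc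
    set w := (l * r / 4 * ‖p - q‖⁻¹) • (p - q) with hw
    have hwn : ‖w‖ = l * r / 4 := by
      rw [hw, norm_smul, Real.norm_of_nonneg (by positivity), mul_assoc,
        inv_mul_cancel₀ hpos.ne', mul_one]
    have hwi : inner ℝ p w - inner ℝ q w = l * r / 4 * ‖p - q‖ := by
      rw [← inner_sub_left, hw, inner_smul_right, real_inner_self_eq_norm_sq]
      field_simp
    have hzx : ‖y + w - x‖ < l * r := by
      rw [add_sub_right_comm]
      linarith [norm_add_le (y - x) w]
    have hz3 : y + w ∈ ball (0 : EuclideanSpace ℝ (Fin n)) 3 := by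
      rw [mem_ball_zero_iff]
      linarith [norm_le_norm_add_norm_sub' (y + w) x]
    have e1 := hgood.envelope (y + w) (by rwa [mem_ball, dist_eq_norm])
    have e2 := hq _ hz3
    have e3 := hp.concaveEnvelope_le hy3
    rw [add_sub_right_comm y w x, inner_add_right] at e1
    rw [add_sub_cancel_left] at e2
    rw [norm_sub_rev]
    linarith
  · rw [Measure.addHaar_closedBall _ _ (by positivity), hω, finrank_euclideanSpace_fin,
      ← ENNReal.ofReal_mul (by positivity), mul_comm]

/-- The dilated cube contains the ball of radius `r` around `x` and has side at most `5 r`, so the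
density in the ball passes to the cube with loss `5^n`. Closeness to the plane implies closeness to
`Γ`, which lies below it. -/
theorem volume_detachment_ge {l r s η ν T : ℝ} (hr : 0 < r) (hr1 : r ≤ 1) (hs : 0 < s) (hν : 0 ≤ ν) (hη0 : 0 ≤ η)
    (hη : r + s / 2 ≤ η * s / 2) (hη5 : η * s ≤ 5 * r)
    {x p c : EuclideanSpace ℝ (Fin n)}
    (hx : x ∈ ball 0 1) (hp : IsSupportingAt u x p) (hgood : IsGoodRadius u x p l ν T r)
    (hxc : ∀ i, |x i - c i| ≤ s / 2) :
    ENNReal.ofReal (ν / 5 ^ n) * volume (openCube c (η * s)) ≤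
      volume {y | y ∈ openCube c (η * s) ∧ concaveEnvelope u y - T ≤ u y} := by
  have hx1 : ‖x‖ < 1 := by simpa using hx
  calc ENNReal.ofReal (ν / 5 ^ n) * volume (openCube c (η * s))
      ≤ ENNReal.ofReal (ν * r ^ n) := by
        rw [volume_openCube _ (by positivity), ← ENNReal.ofReal_mul (by positivity)]
        apply ENNReal.ofReal_le_ofReal
        calc ν / 5 ^ n * (η * s) ^ n ≤ ν / 5 ^ n * (5 * r) ^ n := by gcongr
          _ = ν * r ^ n := by rw [mul_pow]; field_simp
    _ ≤ volume {h | h ∈ ball 0 r ∧ u x + inner ℝ p h - T ≤ u (x + h)} := hgood.density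
    _ ≤ volume ((fun h => x + h) ⁻¹'
          {y | y ∈ openCube c (η * s) ∧ concaveEnvelope u y - T ≤ u y}) := by
        refine measure_mono fun h hh => ?_
        have hhr : ‖h‖ < r := by simpa using hh.1
        have h1 := hp.concaveEnvelope_le (y := x + h) (by
          rw [mem_ball_zero_iff]; linarith [norm_add_le x h])
        rw [add_sub_cancel_left] at h1
        exact ⟨mem_openCube_of_norm_lt hxc (by simpa using hhr) hη, by linarith [hh.2]⟩
    _ = _ := measure_preimage_add _ _ _

/-! ### Stopping-time selection in the dyadic grid. -/

/-- A set whose points all lie in a cube with property `P` of some level below `K` of the dyadic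
grid is covered by finitely many disjoint cubes of the grid with property `P`. -/
theorem exists_dyadic_covering {A : Set (EuclideanSpace ℝ (Fin n))} (hA : A ⊆ ball 0 1) {s₀ : ℝ}
    (hs₀ : 0 < s₀) {K : ℕ} (P : EuclideanSpace ℝ (Fin n) → ℝ → Prop)
    (hP : ∀ x ∈ A, ∃ k < K, ∀ c : EuclideanSpace ℝ (Fin n),
      (∀ i, |x i - c i| ≤ s₀ / 2 ^ k / 2) → P c (s₀ / 2 ^ k)) :
    ∃ (m : ℕ) (c : Fin m → EuclideanSpace ℝ (Fin n)) (s : Fin m → ℝ),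
      (∀ j, ∃ k : ℕ, s j = s₀ / 2 ^ k) ∧
      (Pairwise fun i j => Disjoint (openCube (c i) (s i)) (openCube (c j) (s j))) ∧
      (A ⊆ ⋃ j, closure (openCube (c j) (s j))) ∧
      (∀ j, (A ∩ closure (openCube (c j) (s j))).Nonempty) ∧ ∀ j, P (c j) (s j) := by
  classical
  let σ : ℕ → ℝ := fun k => s₀ / 2 ^ k
  have hσ : ∀ k, 0 < σ k := fun k => by positivity
  -- The floor assigns each point to one half-open cube per level. The point may lie on the boundary
  -- of the open cube, so only the closures cover.
  let idx : ℕ → EuclideanSpace ℝ (Fin n) → Fin n → ℤ := fun k x i => ⌊x i / σ k⌋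
  let ctr : ℕ → (Fin n → ℤ) → EuclideanSpace ℝ (Fin n) := fun k z =>
    WithLp.toLp 2 fun i => ((z i : ℝ) + 1 / 2) * σ k
  have hin : ∀ k x i, |x i - ctr k (idx k x) i| ≤ σ k / 2 := by
    intro k x i
    have h1 := Int.floor_le (x i / σ k)
    have h2 := Int.lt_floor_add_one (x i / σ k)
    rw [le_div_iff₀ (hσ k)] at h1
    rw [div_lt_iff₀ (hσ k)] at h2
    simp only [ctr, idx]
    rw [abs_le]
    constructor <;> linarith
  have hidx : ∀ k z y, y ∈ openCube (ctr k z) (σ k) → idx k y = z := by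
    intro k z y hy
    funext i
    have h1 := abs_lt.1 (hy i)
    simp only [ctr] at h1
    simp only [idx]
    rw [Int.floor_eq_iff, le_div_iff₀ (hσ k), div_lt_iff₀ (hσ k)]
    constructor <;> linarith [h1.1, h1.2]
  -- A cube determines its ancestors, as `⌊t / m⌋ = ⌊t⌋ / m` for a positive integer `m`.
  have hcoarse : ∀ k k', k ≤ k' → ∀ x y, idx k' x = idx k' y → idx k x = idx k y := by
    intro k k' hk x y h
    funext i
    have h1 := congrFun h i
    have h2 : ∀ t : ℝ, ⌊t / σ k⌋ = ⌊t / σ k'⌋ / ((2 ^ (k' - k) : ℕ) : ℤ) := by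
      intro t
      rw [← Int.floor_div_natCast]
      congr 1
      obtain ⟨d, rfl⟩ := Nat.exists_eq_add_of_le hk
      simp only [σ, Nat.add_sub_cancel_left, pow_add]
      push_cast
      field_simp
    simp only [idx] at h1 ⊢
    rw [h2, h2, h1]
  have hex : ∀ x ∈ A, ∃ k, P (ctr k (idx k x)) (σ k) := fun x hx => by
    obtain ⟨k, -, hk⟩ := hP x hx
    exact ⟨k, hk _ (hin k x)⟩
  -- The coarsest level at which the cube of `x` has property `P`.
  let lev : A → ℕ := fun x => Nat.find (hex x x.2)
  have hlev : ∀ x : A, P (ctr (lev x) (idx (lev x) x)) (σ (lev x)) := fun x =>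
    Nat.find_spec (hex x x.2)
  have hlevK : ∀ x : A, lev x < K := fun x => by
    obtain ⟨k, hkK, hk⟩ := hP x x.2
    exact (Nat.find_min' (hex x x.2) (hk _ (hin k x))).trans_lt hkK
  let T : Set (ℕ × (Fin n → ℤ)) := Set.range fun x : A => (lev x, idx (lev x) x)
  have hT : T.Finite := by
    obtain ⟨B, hB⟩ := exists_nat_ge (2 ^ K / s₀)
    refine ((Set.finite_Iio K).prod (Set.Finite.pi fun _ : Fin n =>
      Set.finite_Icc (-(B : ℤ)) B)).subset ?_
    rintro _ ⟨x, rfl⟩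
    refine ⟨hlevK x, fun i _ => ?_⟩
    have h1 : |(x : EuclideanSpace ℝ (Fin n)) i| ≤ 1 := by
      have h2 := PiLp.norm_apply_le (x : EuclideanSpace ℝ (Fin n)) i
      have h3 := hA x.2
      rw [mem_ball_zero_iff] at h3
      exact h2.trans h3.le
    have h4 : |(x : EuclideanSpace ℝ (Fin n)) i / σ (lev x)| ≤ B := by
      rw [abs_div, abs_of_pos (hσ _)]
      calc |(x : EuclideanSpace ℝ (Fin n)) i| / σ (lev x) ≤ 1 / σ (lev x) := by
            have := hσ (lev x)
            gcongr
        _ = 2 ^ lev x / s₀ := by simp only [σ]; rw [one_div_div]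
        _ ≤ 2 ^ K / s₀ := by
            gcongr
            · norm_num
            · exact (hlevK x).le
        _ ≤ B := hB
    rw [abs_le] at h4
    constructor
    · exact Int.le_floor.2 (by push_cast; exact h4.1)
    · have h5 := (Int.floor_le ((x : EuclideanSpace ℝ (Fin n)) i / σ (lev x))).trans h4.2
      have h6 : ⌊(x : EuclideanSpace ℝ (Fin n)) i / σ (lev x)⌋ ≤ (B : ℤ) :=
        (Int.cast_le (R := ℝ)).1 (by rw [Int.cast_natCast]; exact h5)
      exact h6
  have := hT.fintype
  let e := Fintype.equivFin T
  have hmem : ∀ j, ∃ x : A, (e.symm j : ℕ × (Fin n → ℤ)) = (lev x, idx (lev x) x) := fun j => by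
    obtain ⟨x, hx⟩ := (e.symm j).2
    exact ⟨x, hx.symm⟩
  choose X hX using hmem
  -- If two selected cubes meet, the coarser one is the ancestor of the finer one. Since `P`
  -- concerns the cube alone, it would have stopped `x'` at the coarser level, so the levels agree.
  have key : ∀ x x' : A, lev x ≤ lev x' →
      ¬ Disjoint (openCube (ctr (lev x) (idx (lev x) x)) (σ (lev x)))
        (openCube (ctr (lev x') (idx (lev x') x')) (σ (lev x'))) →
      (lev x, idx (lev x) x) = (lev x', idx (lev x') x') := by
    intro x x' hle hnd
    obtain ⟨y, hy, hy'⟩ := Set.not_disjoint_iff.1 hnd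
    have h1 := hidx _ _ _ hy
    have h2 := hidx _ _ _ hy'
    have h3 := hcoarse _ _ hle _ _ h2
    rw [h1] at h3
    have h4 : lev x' ≤ lev x := Nat.find_min' (hex x' x'.2) (by
      rw [← h3]; exact hlev x)
    have h5 := le_antisymm hle h4
    rw [h3, h5]
  refine ⟨Fintype.card T, fun j => ctr (lev (X j)) (idx (lev (X j)) (X j)), fun j => σ (lev (X j)),
    fun j => ⟨_, rfl⟩, ?_, ?_, fun j => ⟨X j, (X j).2, mem_closure_openCube (hσ _) (hin _ _)⟩,
    fun j => hlev _⟩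
  · intro i j hij
    by_contra hnd
    have heq : (e.symm i : ℕ × (Fin n → ℤ)) = e.symm j := by
      rw [hX i, hX j]
      rcases le_total (lev (X i)) (lev (X j)) with h | h
      · exact key _ _ h hnd
      · exact (key _ _ h fun hd => hnd hd.symm).symm
    exact hij (e.symm.injective (Subtype.ext heq))
  · intro x hx
    have hxT : (lev ⟨x, hx⟩, idx (lev ⟨x, hx⟩) x) ∈ T := ⟨⟨x, hx⟩, rfl⟩
    have h1 := hX (e ⟨_, hxT⟩)
    rw [Equiv.symm_apply_apply] at h1
    obtain ⟨h2, h3⟩ := Prod.ext_iff.1 h1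
    refine Set.mem_iUnion.2 ⟨e ⟨_, hxT⟩, ?_⟩
    simp only at h2 h3
    beta_reduce
    rw [← h3, ← h2]
    exact mem_closure_openCube (hσ _) (hin _ _)

/-! ### Choice of constants and conclusion. -/

/-- The cubes which contain a contact point `x` and whose side is a fixed multiple of a good radius
satisfy the gradient and detachment estimates. -/
theorem IsGoodRadius.cube_estimates (hn : 1 ≤ n) {l r s ν C C₂ ω : ℝ}
    (hω : volume (ball (0 : EuclideanSpace ℝ (Fin n)) 1) = ENNReal.ofReal ω)
    (hl : 0 < l) (hl1 : l ≤ 1) (hr : 0 < r) (hr1 : r ≤ 1) (hs : 0 < s) (hsr : √n * s = l * r / 2)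
    (hν : 0 ≤ ν) (hC : 0 ≤ C) (hC₂ : ω * (8 * C * √n / l ^ 2) ^ n ≤ C₂)
    (hC₂' : 64 * n * C / l ^ 2 ≤ C₂) (hf : ContinuousOn f (closedBall 0 1))
    {x p c : EuclideanSpace ℝ (Fin n)} (hfx : 0 ≤ f x)
    (hx : x ∈ ball 0 1) (hp : IsSupportingAt u x p)
    (hgood : IsGoodRadius u x p l ν (C * f x * r ^ 2) r) (hxc : ∀ i, |x i - c i| ≤ s / 2) :
    volume (gradImage (concaveEnvelope u) (closure (openCube c s))) ≤
        ENNReal.ofReal (C₂ * cubeSup f c s ^ n) * volume (openCube c s) ∧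
      ENNReal.ofReal (ν / 5 ^ n) * volume (openCube c ((1 + 8 / l) * √n * s)) ≤
        volume {y | y ∈ openCube c ((1 + 8 / l) * √n * s) ∧
          concaveEnvelope u y - C₂ * cubeSup f c s * diam (openCube c s) ^ 2 ≤ u y} := by
  have hxcl := mem_closure_openCube hs hxc
  have hfF := le_cubeSup hf hxcl (ball_subset_closedBall hx)
  set F := cubeSup f c s with hF
  have hF0 : 0 ≤ F := hfx.trans hfF
  have hn1 : (1 : ℝ) ≤ √n := Real.one_le_sqrt.2 (by exact_mod_cast hn)
  have hr_eq : r = 2 * √n * s / l := by field_simp; linarith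
  have hC₂0 : 0 ≤ C₂ := le_trans (by positivity) hC₂'
  constructor
  · refine (volume_gradImage_le hn hω hl hl1 hr hr1 hs.le hsr (by positivity) hx hp hgood
      hxcl).trans ?_
    rw [volume_openCube _ hs.le, ← ENNReal.ofReal_mul (by positivity)]
    apply ENNReal.ofReal_le_ofReal
    have e : 4 * (C * f x * r ^ 2) / (l * r) = 8 * C * √n / l ^ 2 * f x * s := by
      have : 4 * (C * f x * r ^ 2) / (l * r) = 4 * C * f x * r / l := by field_simp
      rw [this, hr_eq]
      field_simp
      ring
    rw [e, mul_pow, mul_pow]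
    calc ω * ((8 * C * √n / l ^ 2) ^ n * f x ^ n * s ^ n)
        = ω * (8 * C * √n / l ^ 2) ^ n * f x ^ n * s ^ n := by ring
      _ ≤ C₂ * F ^ n * s ^ n := by gcongr
  -- This side length explains `η`: since `√n * s = l r/2`, half of it is `2 r + l r/4`, enough to
  -- contain the ball of radius `r`, and it stays below `5 r`.
  · have hηs : (1 + 8 / l) * √n * s = l * r / 2 + 4 * r := by
      rw [mul_assoc, hsr]; field_simp; ring
    have hs2 : s ≤ l * r / 2 := by nlinarith
    have hlr : l * r ≤ r := by nlinarith
    refine (volume_detachment_ge (η := (1 + 8 / l) * √n) hr hr1 hs hν (by positivity)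
      (by rw [hηs]; linarith) (by rw [hηs]; linarith) hx hp hgood hxc).trans (measure_mono ?_)
    rintro y ⟨hy, hyu⟩
    refine ⟨hy, le_trans ?_ hyu⟩
    have hd := le_diam_openCube hn c hs
    have hr2 : r ^ 2 = 4 * n * s ^ 2 / l ^ 2 := by
      rw [hr_eq, div_pow, mul_pow, mul_pow, Real.sq_sqrt (by positivity)]
      norm_num
    have : C * f x * r ^ 2 ≤ C₂ * F * diam (openCube c s) ^ 2 := by
      -- The 64 is `4 · 16`: the 4 comes from `r = 2 √n s / l`, the 16 from the crude bound `s / 4`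
      -- for the diameter.
      calc C * f x * r ^ 2 = 64 * n * C / l ^ 2 * f x * (s / 4) ^ 2 := by
            rw [hr2]; ring
        _ ≤ C₂ * F * diam (openCube c s) ^ 2 := by gcongr
    linarith

end NonlocalABP

theorem corollary4p9 (n : ℕ) (hn : 1 ≤ n) (δ : ℝ) (hδ : 0 < δ) (hδ' : δ < 1) :
    ∃ l ν : ℝ, 0 < l ∧ l < 1 / 2 ∧ 0 < ν ∧
      ∀ lam ρ₀ : ℝ, 0 < lam → 0 < ρ₀ → ρ₀ ≤ l / (16 * (n : ℝ)) →
        ∃ C₂ C₃ : ℝ, 1 ≤ C₂ ∧ 1 ≤ C₃ ∧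
          ∀ (Lam α : ℝ) (u f : EuclideanSpace ℝ (Fin n) → ℝ),
            lam ≤ Lam → 0 < α → α < 2 →
            AEMeasurable u MeasureTheory.volume →
            ContinuousOn f (Metric.closedBall 0 1) →
            (∀ x ∈ Metric.closedBall (0 : EuclideanSpace ℝ (Fin n)) 1, 0 ≤ f x) →
            IsViscositySubsolution δ lam Lam α (Metric.ball 0 1) u f →
            (∀ x ∉ Metric.ball (0 : EuclideanSpace ℝ (Fin n)) 1, u x ≤ 0) →
            (∃ (m : ℕ) (c : Fin m → EuclideanSpace ℝ (Fin n)) (s : Fin m → ℝ),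
              IsCubeCovering u f (ρ₀ * (2 : ℝ) ^ (-1 / (2 - α))) C₂ ν
                ((1 + 8 / l) * Real.sqrt n) c s) ∧
            ∀ (m : ℕ) (c : Fin m → EuclideanSpace ℝ (Fin n)) (s : Fin m → ℝ),
              IsCubeCovering u f (ρ₀ * (2 : ℝ) ^ (-1 / (2 - α))) C₂ ν
                ((1 + 8 / l) * Real.sqrt n) c s →
              BddAbove ((fun x => max (u x) 0) '' Metric.ball 0 1) ∧
              sSup ((fun x => max (u x) 0) '' Metric.ball 0 1) ≤
                C₃ * (∑ j, cubeSup f (c j) (s j) ^ n *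
                  (MeasureTheory.volume (openCube (c j) (s j))).toReal) ^ (1 / (n : ℝ)) := by
  set ω := (volume (ball (0 : EuclideanSpace ℝ (Fin n)) 1)).toReal with hω_def
  have hω : volume (ball (0 : EuclideanSpace ℝ (Fin n)) 1) = ENNReal.ofReal ω :=
    (ENNReal.ofReal_toReal measure_ball_lt_top.ne).symm
  have hω0 : 0 < ω := ENNReal.toReal_pos (measure_ball_pos _ _ one_pos).ne' measure_ball_lt_top.ne
  obtain ⟨l, hl⟩ : ∃ l, l = (1 - δ) / 8 := ⟨_, rfl⟩
  have hl0 : 0 < l := by linarith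
  have hn1 : (1 : ℝ) ≤ n := by exact_mod_cast hn
  have hsn : (1 : ℝ) ≤ √n := Real.one_le_sqrt.2 hn1
  refine ⟨l, ω * l ^ n / 2 / 5 ^ n, hl0, by linarith, by positivity, ?_⟩
  intro lam ρ₀ hlam hρ₀ hρ₀l
  have hρ1 : ρ₀ ≤ 1 := by
    refine hρ₀l.trans ((div_le_one (by positivity)).2 ?_)
    linarith
  -- This is the constant of `exists_volume_le` with `ε₀ = ω l^n / 4`, a quarter of the volume of
  -- the ball of radius `l`.
  obtain ⟨C, hC⟩ : ∃ C, C = 8 / (lam * (ω * l ^ n / 4) * ρ₀ ^ 2) := ⟨_, rfl⟩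
  have hC0 : 0 < C := by rw [hC]; positivity
  obtain ⟨C₂, hC₂1, hC₂a, hC₂b⟩ : ∃ C₂ : ℝ, 1 ≤ C₂ ∧ ω * (8 * C * √n / l ^ 2) ^ n ≤ C₂ ∧
      64 * n * C / l ^ 2 ≤ C₂ :=
    ⟨max 1 (max (ω * (8 * C * √n / l ^ 2) ^ n) (64 * n * C / l ^ 2)), le_max_left _ _,
      (le_max_left _ _).trans (le_max_right _ _), (le_max_right _ _).trans (le_max_right _ _)⟩
  refine ⟨C₂, max 1 (4 * (C₂ / ω) ^ (1 / (n : ℝ))), hC₂1, le_max_left _ _, ?_⟩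
  intro Lam α u f hLam hα0 hα hu hf hf0 hvisc hout
  constructor
  · set D := ρ₀ * (2 : ℝ) ^ (-1 / (2 - α)) with hD
    have hD0 : 0 < D := by positivity
    have hD1 : D ≤ 1 := by
      have h1 : (2 : ℝ) ^ (-1 / (2 - α)) ≤ 1 :=
        Real.rpow_le_one_of_one_le_of_nonpos one_le_two
          (div_nonpos_of_nonpos_of_nonneg (by norm_num) (by linarith))
      exact mul_le_one₀ hρ1 (by positivity) h1
    obtain ⟨K, hK⟩ := exists_le_sum_rpow hρ₀ hρ1 hα0 hα
    set r : ℕ → ℝ := fun k => D / 2 ^ k with hr_def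
    have hr : ∀ k, 0 < r k := fun k => by positivity
    have hrD : ∀ k, r k ≤ D := fun k => div_le_self hD0.le (one_le_pow₀ one_le_two)
    have hr2 : ∀ k, r (k + 1) = r k / 2 := fun k => by
      simp only [hr_def, pow_succ]; field_simp
    -- With this side a cube of level `k` has diameter at most `l * r k / 2`, half the radius of the
    -- ball in which the envelope is controlled.
    set s₀ := l * D / 2 / √n with hs₀
    have hs₀pos : 0 < s₀ := by positivity
    have hside : ∀ k : ℕ, √n * (s₀ / 2 ^ k) = l * r k / 2 := fun k => by
      simp only [hs₀, hr_def]; field_simp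
    obtain ⟨m, c, s, hs, hdisj, hcov, hmeet, hP⟩ := exists_dyadic_covering (A := contactSet u)
      Set.inter_subset_right hs₀pos (K := K)
      (fun c s => volume (gradImage (concaveEnvelope u) (closure (openCube c s))) ≤
          ENNReal.ofReal (C₂ * cubeSup f c s ^ n) * volume (openCube c s) ∧
        ENNReal.ofReal (ω * l ^ n / 2 / 5 ^ n) * volume (openCube c ((1 + 8 / l) * √n * s)) ≤
          volume {y | y ∈ openCube c ((1 + 8 / l) * √n * s) ∧
            concaveEnvelope u y - C₂ * cubeSup f c s * diam (openCube c s) ^ 2 ≤ u y}) (by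
        intro x hx
        have hfx := hf0 x (ball_subset_closedBall hx.2)
        obtain ⟨p, hp, k, hk, hgood⟩ := exists_isGoodRadius hn hδ hδ' hl hlam hLam hα0 hα hu hvisc
          hout hω hω0 hρ₀ hr (fun k => (hrD k).trans hD1) hr2 hK hx hfx
        rw [← hC] at hgood
        exact ⟨k, hk, fun c hc => hgood.cube_estimates hn hω hl0 (by linarith) (hr k)
          ((hrD k).trans hD1) (by positivity) (hside k) (by positivity) hC0.le hC₂a hC₂b hf hfx
          hx.2 hp hc⟩)
    refine ⟨m, c, s, fun j => ?_, hdisj, fun j => ?_, hcov, hmeet, fun j => (hP j).1,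
      fun j => (hP j).2⟩
    · obtain ⟨k, hk⟩ := hs j
      rw [hk]; positivity
    · obtain ⟨k, hk⟩ := hs j
      rw [hk]
      refine (diam_openCube_le _ (by positivity)).trans ?_
      rw [hside]
      nlinarith [hr k, hrD k]
  · intro m c s hcov
    obtain ⟨h1, h2⟩ := sSup_le_of_isCubeCovering hn hvisc.1 hout hf hf0 (by linarith) hcov
    refine ⟨h1, h2.trans (mul_le_mul_of_nonneg_right (le_max_right _ _) ?_)⟩
    refine Real.rpow_nonneg (Finset.sum_nonneg fun j _ => mul_nonneg (pow_nonneg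
      (cubeSup_nonneg hf hf0 (hcov.meets j)) _) ENNReal.toReal_nonneg) _
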